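/- Let $N\ge 3$. Let $V:(0,+\infty)\to[0,+\infty]$ be measurable with $V\in L^1((r_1,r_2))$ for some $r_2>r_1>0$, and let $K:(0,+\infty)\to(0,+\infty)$ be measurable with $K\in L^s_{\mathrm{loc}}((0,+\infty))$ for some $s>\frac{2N}{N+2}$. Put $2^*=\frac{2N}{N-2}$, $D^{1,2}(\mathbb R^N)=\{u\in L^{2^*}(\mathbb R^N):\nabla u\in L^2(\mathbb R^N)\}$ (weak gradient), $$H^1_V=\Big\{u\in D^{1,2}(\mathbb R^N):\int_{\mathbb R^N}V(|x|)u^2\,dx<\infty\Big\},\qquad \|u\|^2=\int_{\mathbb R^N}\big(|\nabla u|^2+V(|x|)u^2\big)\,dx$$ (with the convention $\infty\cdot 0=0$), and let $H^1_{V,\mathrm r}$ be the closure in $H^1_V$ of the set of radial functions $u\in C_c^\infty(\mathbb R^N)$ such that $\int_{\mathbb R^N}V(|x|)u^2\,dx<\infty$. For $q>1$ let $L^q_K=L^q(\mathbb R^N,K(|x|)\,dx)$, and equip the space $L^{q_1}_K+L^{q_2}_K=\{u_1+u_2:u_1\in L^{q_1}_K,\ u_2\in L^{q_2}_K\}$ with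 the norm $\inf_{u_1+u_2=u}\max\{\|u_1\|_{L^{q_1}_K},\|u_2\|_{L^{q_2}_K}\}$. For $q>1$ and $R>0$, with $B_R=\{x\in\mathbb R^N:|x|<R\}$, set $$\mathcal S_0(q,R)=\sup_{u\in H^1_{V,\mathrm r},\,\|u\|=1}\int_{B_R}K(|x|)|u|^q\,dx,\qquad \mathcal S_\infty(q,R)=\sup_{u\in H^1_{V,\mathrm r},\,\|u\|=1}\int_{\mathbb R^N\setminus B_R}K(|x|)|u|^q\,dx,$$ both in $[0,+\infty]$. Let $q_1,q_2>1$. (i) If $$\mathcal S_0(q_1,R_1)<\infty\ \text{ and }\ \mathcal S_\infty(q_2,R_2)<\infty\ \text{ for some }R_1,R_2>0,\tag{S$'$}$$ then $H^1_{V,\mathrm r}$ is continuously embedded into $L^{q_1}_K+L^{q_2}_K$. (ii) If $$\lim_{R\to0^+}\mathcal S_0(q_1,R)=\lim_{R\to+\infty}\mathcal S_\infty(q_2,R)=0,\tag{S$''$}$$ then $H^1_{V,\mathrm r}$ is compactly embedded into $L^{q_1}_K+L^{q_2}_K$. (iii) If $K(|\cdot|)\in L^1(B_1)$ and $q_1\le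 q_2$, then these conditions are also necessary: if $H^1_{V,\mathrm r}$ is continuously embedded into $L^{q_1}_K+L^{q_2}_K$, then (S$'$) holds, and if it is compactly embedded there, then (S$''$) holds. -/

import Mathlib

open MeasureTheory Filter Topology
open scoped ENNReal NNReal ContDiff

noncomputable section

namespace WeightedSobolev

/-- `ℝ^N` with the Euclidean norm and Lebesgue measure. -/
abbrev Space (N : ℕ) : Type := EuclideanSpace ℝ (Fin N)

/-! ### The potentials -/

/-- Assumption `(V)` on a potential `V : (0,∞) → [0,∞]`; the values of `V` outside `(0,∞)` play
no role. Measurability is Lebesgue measurability on `(0,∞)`. -/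
structure IsPotentialV (V : ℝ → ℝ≥0∞) : Prop where
  measurable : AEMeasurable V (volume.restrict (Set.Ioi 0))
  integrable : ∃ r₁ r₂ : ℝ, 0 < r₁ ∧ r₁ < r₂ ∧ (∫⁻ r in Set.Ioo r₁ r₂, V r) < ⊤

/-- Assumption `(K)` in dimension `N` on a potential `K : (0,∞) → (0,∞)`; the values of `K`
outside `(0,∞)` play no role. Measurability is Lebesgue measurability on `(0,∞)`. -/
structure IsPotentialK (N : ℕ) (K : ℝ → ℝ) : Prop where
  measurable : AEMeasurable K (volume.restrict (Set.Ioi 0))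
  pos : ∀ r : ℝ, 0 < r → 0 < K r
  locally_memLp : ∃ s : ℝ, 2 * (N : ℝ) / ((N : ℝ) + 2) < s ∧
    ∀ a b : ℝ, 0 < a → a < b → MemLp K (ENNReal.ofReal s) (volume.restrict (Set.Icc a b))

/-! ### The space `D^{1,2}` -/

/-- `g` is the weak (distributional) gradient of `u` on `ℝ^N`. -/
structure HasWeakGradient {N : ℕ} (u : Space N → ℝ) (g : Space N → Space N) : Prop where
  locallyIntegrable : LocallyIntegrable u
  locallyIntegrable_grad : LocallyIntegrable g
  integral_eq : ∀ φ : Space N → ℝ, ContDiff ℝ ∞ φ → HasCompactSupport φ → ∀ v : Space N,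
    ∫ x, u x * fderiv ℝ φ x v = - ∫ x, inner ℝ (g x) v * φ x

open Classical in
/-- The weak gradient of `u` (unique up to null sets), and `0` if there is none. -/
def weakGrad {N : ℕ} (u : Space N → ℝ) : Space N → Space N :=
  if h : ∃ g : Space N → Space N, HasWeakGradient u g then h.choose else 0

/-- The critical Sobolev exponent `2^* = 2N/(N-2)`. -/
def critExp (N : ℕ) : ℝ := 2 * (N : ℝ) / ((N : ℝ) - 2)

/-- `u ∈ D^{1,2}(ℝ^N)`: `u ∈ L^{2^*}` has a weak gradient, and it lies in `L²`. -/
structure MemD12 {N : ℕ} (u : Space N → ℝ) : Prop where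
  memLp : MemLp u (ENNReal.ofReal (critExp N))
  exists_grad : ∃ g : Space N → Space N, HasWeakGradient u g
  memLp_grad : MemLp (weakGrad u) 2

/-! ### The energy space and its radial subspace -/

/-- `∫ V(|x|) u² dx`, with the convention `∞ * 0 = 0`. -/
def potentialEnergy {N : ℕ} (V : ℝ → ℝ≥0∞) (u : Space N → ℝ) : ℝ≥0∞ :=
  ∫⁻ x, V ‖x‖ * ‖u x‖ₑ ^ 2

/-- `u ∈ H^1_V(ℝ^N)`. -/
structure MemHV {N : ℕ} (V : ℝ → ℝ≥0∞) (u : Space N → ℝ) : Prop where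
  memD12 : MemD12 u
  energy_lt_top : potentialEnergy V u < ⊤

/-- The norm `(∫ |∇u|² + V(|x|) u² dx)^{1/2}` of `u ∈ H^1_V`. -/
def normHV {N : ℕ} (V : ℝ → ℝ≥0∞) (u : Space N → ℝ) : ℝ≥0∞ :=
  ((∫⁻ x, ‖weakGrad u x‖ₑ ^ 2) + potentialEnergy V u) ^ (1 / 2 : ℝ)

/-- `φ` is a radial function in `C_c^∞(ℝ^N)` with `∫ V(|x|) φ² dx < ∞`. -/
structure IsRadialTest {N : ℕ} (V : ℝ → ℝ≥0∞) (φ : Space N → ℝ) : Prop where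
  contDiff : ContDiff ℝ ∞ φ
  hasCompactSupport : HasCompactSupport φ
  radial : ∀ x y : Space N, ‖x‖ = ‖y‖ → φ x = φ y
  energy_lt_top : potentialEnergy V φ < ⊤

/-- `u ∈ H^1_{V,r}(ℝ^N)`: `u` lies in the closure in `H^1_V` of the radial functions in `C_c^∞`
with finite potential energy. -/
structure MemHVr {N : ℕ} (V : ℝ → ℝ≥0∞) (u : Space N → ℝ) : Prop where
  memHV : MemHV V u
  mem_closure : ∀ ε : ℝ≥0∞, 0 < ε →
    ∃ φ : Space N → ℝ, IsRadialTest V φ ∧ normHV V (fun x => u x - φ x) < ε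

/-! ### Weighted Lebesgue spaces and their sum -/

/-- The measure `K(|x|) dx` on `ℝ^N`, so that `L^q_K = L^q(weightMeasure N K)`. -/
def weightMeasure (N : ℕ) (K : ℝ → ℝ) : Measure (Space N) :=
  (volume : Measure (Space N)).withDensity (fun x => ENNReal.ofReal (K ‖x‖))

/-- `u = u₁ + u₂` almost everywhere, with `u₁ ∈ L^{q₁}_K` and `u₂ ∈ L^{q₂}_K`. -/
structure IsDecomp {N : ℕ} (K : ℝ → ℝ) (q₁ q₂ : ℝ) (u u₁ u₂ : Space N → ℝ) : Prop where
  left : MemLp u₁ (ENNReal.ofReal q₁) (weightMeasure N K)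
  right : MemLp u₂ (ENNReal.ofReal q₂) (weightMeasure N K)
  add_eq : ∀ᵐ x, u x = u₁ x + u₂ x

/-- `u ∈ L^{q₁}_K + L^{q₂}_K`. -/
def MemSum {N : ℕ} (K : ℝ → ℝ) (q₁ q₂ : ℝ) (u : Space N → ℝ) : Prop :=
  ∃ u₁ u₂ : Space N → ℝ, IsDecomp K q₁ q₂ u u₁ u₂

/-- The norm of `L^{q₁}_K + L^{q₂}_K`: the infimum of `max (‖u₁‖, ‖u₂‖)` over all decompositions
`u = u₁ + u₂`. -/
def normSum {N : ℕ} (K : ℝ → ℝ) (q₁ q₂ : ℝ) (u : Space N → ℝ) : ℝ≥0∞ :=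
  ⨅ (u₁ : Space N → ℝ) (u₂ : Space N → ℝ) (_ : IsDecomp K q₁ q₂ u u₁ u₂),
    max (eLpNorm u₁ (ENNReal.ofReal q₁) (weightMeasure N K))
      (eLpNorm u₂ (ENNReal.ofReal q₂) (weightMeasure N K))

/-! ### Embeddings -/

/-- `H^1_{V,r}(ℝ^N)` is continuously embedded into `L^{q₁}_K + L^{q₂}_K`. -/
def ContinuouslyEmbedded (N : ℕ) (V : ℝ → ℝ≥0∞) (K : ℝ → ℝ) (q₁ q₂ : ℝ) : Prop :=
  ∃ C : ℝ≥0, ∀ u : Space N → ℝ, MemHVr V u →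
    MemSum K q₁ q₂ u ∧ normSum K q₁ q₂ u ≤ C * normHV V u

/-- `H^1_{V,r}(ℝ^N)` is compactly embedded into `L^{q₁}_K + L^{q₂}_K`: the embedding is continuous
and every bounded sequence of `H^1_{V,r}` has a subsequence that converges in the sum space. -/
def CompactlyEmbedded (N : ℕ) (V : ℝ → ℝ≥0∞) (K : ℝ → ℝ) (q₁ q₂ : ℝ) : Prop :=
  ContinuouslyEmbedded N V K q₁ q₂ ∧
  ∀ u : ℕ → Space N → ℝ, (∀ n, MemHVr V (u n)) →
    (∃ M : ℝ≥0, ∀ n, normHV V (u n) ≤ M) →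
    ∃ w : Space N → ℝ, MemSum K q₁ q₂ w ∧ ∃ k : ℕ → ℕ, StrictMono k ∧
      Tendsto (fun n => normSum K q₁ q₂ (fun x => u (k n) x - w x)) atTop (𝓝 0)

/-! ### The functions `S_0` and `S_∞` -/

/-- `S_0(q,R) = sup { ∫_{B_R} K(|x|) |u|^q dx : u ∈ H^1_{V,r}, ‖u‖ = 1 }`. -/
def Szero (N : ℕ) (V : ℝ → ℝ≥0∞) (K : ℝ → ℝ) (q R : ℝ) : ℝ≥0∞ :=
  ⨆ (u : Space N → ℝ) (_ : MemHVr V u) (_ : normHV V u = 1),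
    ∫⁻ x in Metric.ball (0 : Space N) R, ENNReal.ofReal (K ‖x‖) * ‖u x‖ₑ ^ q

/-- `S_∞(q,R) = sup { ∫_{ℝ^N ∖ B_R} K(|x|) |u|^q dx : u ∈ H^1_{V,r}, ‖u‖ = 1 }`. -/
def Sinfty (N : ℕ) (V : ℝ → ℝ≥0∞) (K : ℝ → ℝ) (q R : ℝ) : ℝ≥0∞ :=
  ⨆ (u : Space N → ℝ) (_ : MemHVr V u) (_ : normHV V u = 1),
    ∫⁻ x in (Metric.ball (0 : Space N) R)ᶜ, ENNReal.ofReal (K ‖x‖) * ‖u x‖ₑ ^ q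

/-- `S_0(q₁,R₁) < ∞` and `S_∞(q₂,R₂) < ∞` for some `R₁, R₂ > 0`. -/
def CondFinite (N : ℕ) (V : ℝ → ℝ≥0∞) (K : ℝ → ℝ) (q₁ q₂ : ℝ) : Prop :=
  ∃ R₁ R₂ : ℝ, 0 < R₁ ∧ 0 < R₂ ∧ Szero N V K q₁ R₁ < ⊤ ∧ Sinfty N V K q₂ R₂ < ⊤

/-- `S_0(q₁,R) → 0` as `R → 0⁺` and `S_∞(q₂,R) → 0` as `R → +∞`. -/
def CondVanishing (N : ℕ) (V : ℝ → ℝ≥0∞) (K : ℝ → ℝ) (q₁ q₂ : ℝ) : Prop :=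
  Tendsto (fun R => Szero N V K q₁ R) (𝓝[>] 0) (𝓝 0) ∧
  Tendsto (fun R => Sinfty N V K q₂ R) atTop (𝓝 0)

end WeightedSobolev

end

open WeightedSobolev

/-! The finiteness of `∫ |∇φ|²` for a radial test function `φ = f(|·|)` says that
`∫ r^{N-1} f'(r)² dr` is finite, and Cauchy–Schwarz then bounds `f` by `C r^{(2-N)/2}` and makes it
`1/2`-Hölder away from `0`, uniformly on bounded sets of `H^1_{V,r}`. Both bounds pass to limits:
every `u ∈ H^1_{V,r}` is radial and obeys them almost everywhere, bounded sequences in `H^1_{V,r}`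
have subsequences converging almost everywhere (Arzelà–Ascoli on `(0,∞)`), and any annulus
contributes only a finite amount to `S_0` and `S_∞`, because `K` is integrable on it.

For sufficiency, cut `u` at a sphere: the inner part lies in `L^{q₁}_K`, the outer part in
`L^{q₂}_K`. Along an a.e. convergent subsequence the two ends are small by the vanishing of `S_0`
and `S_∞`, and dominated convergence takes care of the annulus in between.

For necessity, let `u = u₁ + u₂`. Inside `B_1` the measure `K(|x|) dx` is finite, so `q₁ ≤ q₂` lets
Hölder's inequality bound `u` in `L^{q₁}_K`. Outside, `u` is bounded, so where `|u₁| ≥ |u₂|` one has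
`|u|^{q₂} ≤ C |u₁|^{q₁}`, which bounds `u` in `L^{q₂}_K`. If `S_0` or `S_∞` did not tend to `0`,
there would be unit vectors `u_n` carrying a fixed mass on balls shrinking to `0`, or on complements
of balls growing to `ℝ^N`. A subsequence is Cauchy in the local norm, and a fixed term of it has
vanishing mass on these sets: a contradiction. -/

noncomputable section

namespace WeightedSobolev

section WeakGradient

variable {N : ℕ} {u v φ : Space N → ℝ} {g h : Space N → Space N}

theorem locallyIntegrable_inner_const (hg : LocallyIntegrable g) (e : Space N) :
    LocallyIntegrable fun x ↦ inner ℝ (g x) e :=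
  locallyIntegrable_iff.2 fun k hk ↦ (locallyIntegrable_iff.1 hg k hk).inner_const e

theorem integrable_mul_of_hasCompactSupport (hu : LocallyIntegrable u) (hφ : Continuous φ)
    (hc : HasCompactSupport φ) : Integrable fun x ↦ u x * φ x := by
  simpa only [smul_eq_mul, mul_comm] using hu.integrable_smul_left_of_hasCompactSupport hφ hc

theorem integrable_mul_fderiv_of_hasCompactSupport (hu : LocallyIntegrable u)
    (hφ : ContDiff ℝ ∞ φ) (hc : HasCompactSupport φ) (e : Space N) :
    Integrable fun x ↦ u x * fderiv ℝ φ x e :=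
  integrable_mul_of_hasCompactSupport hu
    ((hφ.continuous_fderiv (by simp)).clm_apply continuous_const) (hc.fderiv_apply (𝕜 := ℝ) e)

theorem integrable_inner_mul_of_hasCompactSupport (hg : LocallyIntegrable g) (hφ : Continuous φ)
    (hc : HasCompactSupport φ) (e : Space N) : Integrable fun x ↦ inner ℝ (g x) e * φ x :=
  integrable_mul_of_hasCompactSupport (locallyIntegrable_inner_const hg e) hφ hc

theorem HasWeakGradient.sub (hu : HasWeakGradient u g) (hv : HasWeakGradient v h) :
    HasWeakGradient (fun x ↦ u x - v x) (fun x ↦ g x - h x) where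
  locallyIntegrable := hu.locallyIntegrable.sub hv.locallyIntegrable
  locallyIntegrable_grad := hu.locallyIntegrable_grad.sub hv.locallyIntegrable_grad
  integral_eq φ hφ hc e := by
    simp_rw [inner_sub_left, sub_mul]
    rw [integral_sub (integrable_mul_fderiv_of_hasCompactSupport hu.locallyIntegrable hφ hc e)
        (integrable_mul_fderiv_of_hasCompactSupport hv.locallyIntegrable hφ hc e),
      integral_sub
        (integrable_inner_mul_of_hasCompactSupport hu.locallyIntegrable_grad hφ.continuous hc e)
        (integrable_inner_mul_of_hasCompactSupport hv.locallyIntegrable_grad hφ.continuous hc e),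
      hu.integral_eq φ hφ hc, hv.integral_eq φ hφ hc]
    ring

theorem HasWeakGradient.const_mul (hu : HasWeakGradient u g) (c : ℝ) :
    HasWeakGradient (fun x ↦ c * u x) (fun x ↦ c • g x) where
  locallyIntegrable := hu.locallyIntegrable.smul c
  locallyIntegrable_grad := hu.locallyIntegrable_grad.smul c
  integral_eq φ hφ hc e := by
    simp_rw [real_inner_smul_left, mul_assoc]
    rw [integral_const_mul, integral_const_mul, hu.integral_eq φ hφ hc, mul_neg]

theorem ae_eq_zero_of_hasWeakGradient_zero (hg : HasWeakGradient (fun _ ↦ 0) g) :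
    g =ᵐ[volume] 0 := by
  have inner_eq_zero (e : Space N) : ∀ᵐ x, inner ℝ (g x) e = (0 : ℝ) := by
    refine ae_eq_zero_of_integral_contDiff_smul_eq_zero
      (locallyIntegrable_inner_const hg.locallyIntegrable_grad e) fun φ hφ hc ↦ ?_
    simpa only [zero_mul, integral_zero, zero_eq_neg, smul_eq_mul, mul_comm]
      using hg.integral_eq φ hφ hc e
  filter_upwards [ae_all_iff.2 fun i ↦ inner_eq_zero (EuclideanSpace.single i 1)] with x hx
  ext i
  simpa [EuclideanSpace.inner_single_right] using hx i

theorem HasWeakGradient.ae_eq (hg : HasWeakGradient u g) (hh : HasWeakGradient u h) :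
    g =ᵐ[volume] h := by
  have hzero : HasWeakGradient (fun _ ↦ 0) (fun x ↦ g x - h x) := by
    simpa only [sub_self] using hg.sub hh
  filter_upwards [ae_eq_zero_of_hasWeakGradient_zero hzero] with x hx
  exact sub_eq_zero.1 hx

theorem hasWeakGradient_weakGrad (h : ∃ g, HasWeakGradient u g) :
    HasWeakGradient u (weakGrad u) := by
  rw [weakGrad, dif_pos h]
  exact h.choose_spec

theorem HasWeakGradient.weakGrad_ae_eq (hg : HasWeakGradient u g) : weakGrad u =ᵐ[volume] g :=
  (hasWeakGradient_weakGrad ⟨g, hg⟩).ae_eq hg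

theorem continuous_gradient (hu : ContDiff ℝ ∞ u) : Continuous (gradient u) :=
  (InnerProductSpace.toDual ℝ (Space N)).symm.continuous.comp (hu.continuous_fderiv (by simp))

theorem hasWeakGradient_gradient (hu : ContDiff ℝ ∞ u) : HasWeakGradient u (gradient u) where
  locallyIntegrable := hu.continuous.locallyIntegrable
  locallyIntegrable_grad := (continuous_gradient hu).locallyIntegrable
  integral_eq φ hφ hc e := by
    have huloc := hu.continuous.locallyIntegrable (μ := volume)
    have hgrad := integrable_inner_mul_of_hasCompactSupport
      (continuous_gradient hu).locallyIntegrable hφ.continuous hc e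
    simp_rw [inner_gradient_left] at hgrad ⊢
    exact integral_mul_fderiv_eq_neg_fderiv_mul_of_integrable hgrad
      (integrable_mul_fderiv_of_hasCompactSupport huloc hφ hc e)
      (integrable_mul_of_hasCompactSupport huloc hφ.continuous hc)
      (fun x _ ↦ hu.differentiable (by simp) x) (fun x _ ↦ hφ.differentiable (by simp) x)

open scoped Convolution

theorem fderiv_comp_sub_left_apply (hφ : Differentiable ℝ φ) (y t e : Space N) :
    fderiv ℝ (fun t ↦ φ (y - t)) t e = -fderiv ℝ φ (y - t) e := by
  have := ((hφ (y - t)).hasFDerivAt.comp t ((hasFDerivAt_id t).const_sub y)).fderiv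
  simp only [Function.comp_def] at this
  simp [this]

theorem HasWeakGradient.hasGradientAt_convolution (hu : HasWeakGradient u g)
    (hφ : ContDiff ℝ ∞ φ) (hc : HasCompactSupport φ) (y : Space N) :
    HasGradientAt (φ ⋆[ContinuousLinearMap.lsmul ℝ ℝ, volume] u)
      ((φ ⋆[ContinuousLinearMap.lsmul ℝ ℝ, volume] g) y) y := by
  have hderiv := hc.hasFDerivAt_convolution_left (𝕜 := ℝ) (μ := volume)
    (ContinuousLinearMap.lsmul ℝ ℝ : ℝ →L[ℝ] ℝ →L[ℝ] ℝ) (hφ.of_le (by simp))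
    hu.locallyIntegrable y
  suffices heq : InnerProductSpace.toDual ℝ (Space N) ((φ ⋆[.lsmul ℝ ℝ, volume] g) y) =
      (fderiv ℝ φ ⋆[(ContinuousLinearMap.lsmul ℝ ℝ).precompL (Space N), volume] u) y by
    rwa [hasGradientAt_iff_hasFDerivAt, heq]
  refine ContinuousLinearMap.ext fun e ↦ ?_
  have hderiv_int : Integrable fun t ↦ (ContinuousLinearMap.lsmul ℝ ℝ).precompL (Space N)
      (fderiv ℝ φ (y - t)) (u t) :=
    ((hc.fderiv (𝕜 := ℝ)).convolutionExists_left _ (hφ.continuous_fderiv (by simp))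
      hu.locallyIntegrable y).integrable_swap
  have hgrad_int : Integrable fun t ↦ φ (y - t) • g t :=
    (hc.convolutionExists_left (ContinuousLinearMap.lsmul ℝ ℝ) hφ.continuous
      hu.locallyIntegrable_grad y).integrable_swap
  have hparts := hu.integral_eq (fun t ↦ φ (y - t)) (hφ.comp (contDiff_const.sub contDiff_id))
    (hc.comp_homeomorph (Homeomorph.subLeft y)) e
  simp_rw [fderiv_comp_sub_left_apply (hφ.differentiable (by simp)), mul_neg, integral_neg,
    neg_inj] at hparts
  rw [convolution_eq_swap, convolution_eq_swap, ContinuousLinearMap.integral_apply hderiv_int,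
    InnerProductSpace.toDual_apply_apply, real_inner_comm]
  simp only [ContinuousLinearMap.lsmul_apply]
  rw [← integral_inner hgrad_int]
  simp only [ContinuousLinearMap.precompL_apply, ContinuousLinearMap.lsmul_apply, smul_eq_mul,
    real_inner_smul_right, real_inner_comm, mul_comm] at hparts ⊢
  exact hparts.symm

theorem convolution_eq_const_of_hasWeakGradient_zero (hu : HasWeakGradient u fun _ ↦ 0)
    (hφ : ContDiff ℝ ∞ φ) (hc : HasCompactSupport φ) (x y : Space N) :
    (φ ⋆[ContinuousLinearMap.lsmul ℝ ℝ, volume] u) x =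
      (φ ⋆[ContinuousLinearMap.lsmul ℝ ℝ, volume] u) y := by
  have hderiv (z) : HasFDerivAt (φ ⋆[ContinuousLinearMap.lsmul ℝ ℝ, volume] u)
      (0 : Space N →L[ℝ] ℝ) z := by
    simpa [convolution_def] using (hu.hasGradientAt_convolution hφ hc z).hasFDerivAt
  exact is_const_of_fderiv_eq_zero (𝕜 := ℝ) (fun z ↦ (hderiv z).differentiableAt)
    (fun z ↦ (hderiv z).fderiv) x y

theorem ae_eq_const_of_hasWeakGradient_zero (hu : HasWeakGradient u fun _ ↦ 0) :
    ∃ c : ℝ, ∀ᵐ x, u x = c := by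
  let ψ (n : ℕ) : ContDiffBump (0 : Space N) :=
    ⟨1 / ((n : ℝ) + 1), 2 / ((n : ℝ) + 1), by positivity, by gcongr; norm_num⟩
  have hrad : Tendsto (fun n ↦ (ψ n).rOut) atTop (𝓝 0) := by
    simpa [ψ, div_eq_mul_inv] using
      (tendsto_one_div_add_atTop_nhds_zero_nat (𝕜 := ℝ)).const_mul 2
  have hlim := ContDiffBump.ae_convolution_tendsto_right_of_locallyIntegrable (μ := volume)
    (K := 2) hrad (.of_forall fun n ↦ by simp [ψ, div_eq_mul_inv]) hu.locallyIntegrable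
  obtain ⟨x₀, hx₀⟩ := hlim.exists
  refine ⟨u x₀, hlim.mono fun x hx ↦ tendsto_nhds_unique hx (hx₀.congr fun n ↦ ?_)⟩
  exact convolution_eq_const_of_hasWeakGradient_zero hu (ψ n).contDiff_normed
    (ψ n).hasCompactSupport_normed x₀ x

end WeakGradient

section Polar

variable {E : Type*} [NormedAddCommGroup E] [NormedSpace ℝ E] [MeasurableSpace E] [BorelSpace E]
  [FiniteDimensional ℝ E] [Nontrivial E] (μ : Measure E) [μ.IsAddHaarMeasure]

theorem lintegral_fun_norm_addHaar {f : ℝ → ℝ≥0∞} (hf : Measurable f) :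
    ∫⁻ x, f ‖x‖ ∂μ = μ.toSphere Set.univ *
      ∫⁻ r in Set.Ioi (0 : ℝ), ENNReal.ofReal (r ^ (Module.finrank ℝ E - 1)) * f r :=
  calc
    ∫⁻ x, f ‖x‖ ∂μ = ∫⁻ x : ({0}ᶜ : Set E), f ‖x.1‖ ∂μ.comap Subtype.val := by
      rw [lintegral_subtype_comap (measurableSet_singleton _).compl fun x : E ↦ f ‖x‖,
        restrict_compl_singleton]
    _ = ∫⁻ x, f x.2 ∂μ.toSphere.prod (.volumeIoiPow (Module.finrank ℝ E - 1)) := by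
      simpa using μ.measurePreserving_homeomorphUnitSphereProd.lintegral_comp_emb
        (Homeomorph.measurableEmbedding _) (f ∘ Subtype.val ∘ Prod.snd)
    _ = μ.toSphere Set.univ *
        ∫⁻ r : Set.Ioi (0 : ℝ), f r ∂.volumeIoiPow (Module.finrank ℝ E - 1) := by
      rw [lintegral_prod _ (by fun_prop)]
      simp only [lintegral_const, mul_comm]
    _ = _ := by
      rw [Measure.volumeIoiPow,
        lintegral_withDensity_eq_lintegral_mul _ (by fun_prop) (by fun_prop)]
      exact congrArg _ (lintegral_subtype_comap measurableSet_Ioi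
        fun r ↦ ENNReal.ofReal (r ^ (Module.finrank ℝ E - 1)) * f r)

theorem quasiMeasurePreserving_norm :
    Measure.QuasiMeasurePreserving (‖·‖) μ (volume.restrict (Set.Ioi 0)) := by
  refine ⟨measurable_norm, Measure.AbsolutelyContinuous.mk fun s hs hs0 ↦ ?_⟩
  have hint : ∫⁻ x, s.indicator 1 ‖x‖ ∂μ = 0 := by
    rw [lintegral_fun_norm_addHaar μ (measurable_one.indicator hs),
      lintegral_eq_zero_of_ae_eq_zero, mul_zero]
    filter_upwards [measure_eq_zero_iff_ae_notMem.1 hs0] with r hr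
    simp [Set.indicator_of_notMem hr]
  rwa [Measure.map_apply measurable_norm hs, ← lintegral_indicator_one (measurable_norm hs)]

theorem integrableOn_fun_norm_annulus {f : ℝ → ℝ} (hf : LocallyIntegrableOn f (Set.Ioi 0))
    {a : ℝ} (ha : 0 < a) (b : ℝ) :
    IntegrableOn (fun x ↦ f ‖x‖) (Metric.ball (0 : E) b \ Metric.ball 0 a) μ := by
  have hpow : IntegrableOn (fun r ↦ r ^ (Module.finrank ℝ E - 1) * f r) (Set.Ico a b) :=
    ((hf.integrableOn_compact_subset (fun r hr ↦ ha.trans_le hr.1) isCompact_Icc).continuousOn_mul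
      (by fun_prop) isCompact_Icc).mono_set Set.Ico_subset_Icc_self
  have hind : Integrable (fun x ↦ (Set.Ico a b).indicator f ‖x‖) μ := by
    rw [integrable_fun_norm_addHaar]
    refine ((integrable_indicator_iff measurableSet_Ico).2 hpow).integrableOn.congr_fun
      (fun r _ ↦ ?_) measurableSet_Ioi
    by_cases hr : r ∈ Set.Ico a b <;> simp [hr]
  refine (integrable_indicator_iff (measurableSet_ball.diff measurableSet_ball)).1
    (hind.congr (.of_forall fun x ↦ ?_))
  simp only [Set.indicator, Set.mem_Ico, Set.mem_sdiff, mem_ball_zero_iff, not_lt, and_comm]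

end Polar

section WeightMeasure

variable {N : ℕ} {K : ℝ → ℝ} {A : Set (Space N)}

theorem weightMeasure_absolutelyContinuous : weightMeasure N K ≪ volume :=
  withDensity_absolutelyContinuous _ _

theorem aemeasurable_ofReal_fun_norm [NeZero N] (hK : LocallyIntegrableOn K (Set.Ioi 0)) :
    AEMeasurable fun x : Space N ↦ ENNReal.ofReal (K ‖x‖) :=
  (hK.aestronglyMeasurable.aemeasurable.comp_quasiMeasurePreserving
    (quasiMeasurePreserving_norm volume)).ennreal_ofReal

theorem setLIntegral_weightMeasure (hK : AEMeasurable fun x : Space N ↦ ENNReal.ofReal (K ‖x‖))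
    (hA : MeasurableSet A) (f : Space N → ℝ≥0∞) :
    ∫⁻ x in A, f x ∂weightMeasure N K = ∫⁻ x in A, ENNReal.ofReal (K ‖x‖) * f x :=
  setLIntegral_withDensity_eq_setLIntegral_mul_non_measurable₀ _ hK.restrict f hA
    (.of_forall fun _ ↦ ENNReal.ofReal_lt_top)

theorem weightMeasure_lt_top_of_integrableOn (hA : MeasurableSet A)
    (hK : IntegrableOn (fun x : Space N ↦ K ‖x‖) A) : weightMeasure N K A < ⊤ := by
  rw [weightMeasure, withDensity_apply _ hA]
  exact (lintegral_mono fun x ↦ Real.ofReal_le_enorm _).trans_lt hK.hasFiniteIntegral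

end WeightMeasure

section EnergySpace

variable {N : ℕ} {V : ℝ → ℝ≥0∞} {u v φ ψ : Space N → ℝ}

/-- The measure `V(|x|) dx` on `ℝ^N`, in which the potential energy of `u` is the squared
`L²`-norm of `u`. -/
def potentialMeasure (N : ℕ) (V : ℝ → ℝ≥0∞) : Measure (Space N) :=
  volume.withDensity fun x ↦ V ‖x‖

theorem potentialMeasure_absolutelyContinuous : potentialMeasure N V ≪ volume :=
  withDensity_absolutelyContinuous _ _

theorem lintegral_enorm_sq_eq_eLpNorm_sq {α E : Type*} [MeasurableSpace α] {μ : Measure α}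
    [NormedAddCommGroup E] (f : α → E) :
    ∫⁻ x, ‖f x‖ₑ ^ 2 ∂μ = eLpNorm f 2 μ ^ (2 : ℝ) := by
  simpa using (eLpNorm_nnreal_pow_eq_lintegral (f := f) (μ := μ) (p := 2) two_ne_zero).symm

theorem potentialEnergy_eq_eLpNorm_sq (hV : AEMeasurable fun x : Space N ↦ V ‖x‖)
    (hu : AEMeasurable u) :
    potentialEnergy V u = eLpNorm u 2 (potentialMeasure N V) ^ (2 : ℝ) := by
  rw [← lintegral_enorm_sq_eq_eLpNorm_sq, potentialMeasure,
    lintegral_withDensity_eq_lintegral_mul₀ hV (hu.enorm.pow_const 2)]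
  rfl

theorem potentialEnergy_lt_top_iff (hV : AEMeasurable fun x : Space N ↦ V ‖x‖)
    (hu : AEMeasurable u) : potentialEnergy V u < ⊤ ↔ MemLp u 2 (potentialMeasure N V) := by
  rw [potentialEnergy_eq_eLpNorm_sq hV hu, ENNReal.rpow_lt_top_iff_of_pos two_pos]
  exact ⟨fun h ↦ ⟨hu.aestronglyMeasurable.mono_ac potentialMeasure_absolutelyContinuous, h⟩,
    fun h ↦ h.2⟩

theorem normHV_eq_eLpNorm (hV : AEMeasurable fun x : Space N ↦ V ‖x‖) (hu : AEMeasurable u) :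
    normHV V u = (eLpNorm (weakGrad u) 2 ^ (2 : ℝ) +
      eLpNorm u 2 (potentialMeasure N V) ^ (2 : ℝ)) ^ (1 / 2 : ℝ) := by
  rw [normHV, lintegral_enorm_sq_eq_eLpNorm_sq, potentialEnergy_eq_eLpNorm_sq hV hu]

theorem eLpNorm_weakGrad_le_normHV (V : ℝ → ℝ≥0∞) (u : Space N → ℝ) :
    eLpNorm (weakGrad u) 2 ≤ normHV V u := by
  rw [normHV, lintegral_enorm_sq_eq_eLpNorm_sq, one_div, ENNReal.le_rpow_inv_iff two_pos]
  exact le_self_add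

theorem MemD12.aemeasurable (hu : MemD12 u) : AEMeasurable u :=
  hu.memLp.1.aemeasurable

theorem MemD12.hasWeakGradient (hu : MemD12 u) : HasWeakGradient u (weakGrad u) :=
  hasWeakGradient_weakGrad hu.exists_grad

theorem MemD12.weakGrad_sub (hu : MemD12 u) (hv : MemD12 v) :
    weakGrad (fun x ↦ u x - v x) =ᵐ[volume] weakGrad u - weakGrad v :=
  (hu.hasWeakGradient.sub hv.hasWeakGradient).weakGrad_ae_eq

theorem MemD12.weakGrad_const_mul (hu : MemD12 u) (c : ℝ) :
    weakGrad (fun x ↦ c * u x) =ᵐ[volume] c • weakGrad u :=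
  (hu.hasWeakGradient.const_mul c).weakGrad_ae_eq

theorem MemD12.sub (hu : MemD12 u) (hv : MemD12 v) : MemD12 fun x ↦ u x - v x where
  memLp := hu.memLp.sub hv.memLp
  exists_grad := ⟨_, hu.hasWeakGradient.sub hv.hasWeakGradient⟩
  memLp_grad := (memLp_congr_ae (hu.weakGrad_sub hv)).2 (hu.memLp_grad.sub hv.memLp_grad)

theorem MemD12.const_mul (hu : MemD12 u) (c : ℝ) : MemD12 fun x ↦ c * u x where
  memLp := hu.memLp.const_mul c
  exists_grad := ⟨_, hu.hasWeakGradient.const_mul c⟩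
  memLp_grad := (memLp_congr_ae (hu.weakGrad_const_mul c)).2 (hu.memLp_grad.const_smul c)

theorem rpow_add_rpow_le_add (a b c d : ℝ≥0∞) {p : ℝ} (hp : 1 ≤ p) :
    ((a + b) ^ p + (c + d) ^ p) ^ (1 / p) ≤
      (a ^ p + c ^ p) ^ (1 / p) + (b ^ p + d ^ p) ^ (1 / p) := by
  simpa using ENNReal.Lp_add_le Finset.univ ![a, c] ![b, d] hp

theorem normHV_sub_le (hV : AEMeasurable fun x : Space N ↦ V ‖x‖) (hu : MemD12 u)
    (hv : MemD12 v) : normHV V (fun x ↦ u x - v x) ≤ normHV V u + normHV V v := by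
  have hac := potentialMeasure_absolutelyContinuous (N := N) (V := V)
  rw [normHV_eq_eLpNorm hV hu.aemeasurable, normHV_eq_eLpNorm hV hv.aemeasurable,
    normHV_eq_eLpNorm hV (hu.sub hv).aemeasurable]
  refine le_trans ?_ (rpow_add_rpow_le_add _ _ _ _ one_le_two)
  gcongr
  · rw [eLpNorm_congr_ae (hu.weakGrad_sub hv)]
    exact eLpNorm_sub_le hu.memLp_grad.1 hv.memLp_grad.1 one_le_two
  · exact eLpNorm_sub_le (hu.memLp.1.mono_ac hac) (hv.memLp.1.mono_ac hac) one_le_two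

theorem normHV_const_mul (hV : AEMeasurable fun x : Space N ↦ V ‖x‖) (hu : MemD12 u) (c : ℝ) :
    normHV V (fun x ↦ c * u x) = ‖c‖ₑ * normHV V u := by
  rw [normHV_eq_eLpNorm hV hu.aemeasurable, normHV_eq_eLpNorm hV (hu.const_mul c).aemeasurable,
    eLpNorm_congr_ae (hu.weakGrad_const_mul c), eLpNorm_const_smul,
    show (fun x ↦ c * u x) = c • u from rfl, eLpNorm_const_smul,
    ENNReal.mul_rpow_of_nonneg _ _ zero_le_two, ENNReal.mul_rpow_of_nonneg _ _ zero_le_two,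
    ← mul_add, ENNReal.mul_rpow_of_nonneg _ _ (by norm_num), ← ENNReal.rpow_mul]
  norm_num

theorem MemHV.normHV_ne_top (hu : MemHV V u) : normHV V u ≠ ⊤ := by
  rw [normHV, lintegral_enorm_sq_eq_eLpNorm_sq]
  exact ENNReal.rpow_ne_top_of_nonneg (by norm_num) (ENNReal.add_ne_top.2
    ⟨ENNReal.rpow_ne_top_of_nonneg zero_le_two hu.memD12.memLp_grad.2.ne, hu.energy_lt_top.ne⟩)

theorem MemHV.sub (hV : AEMeasurable fun x : Space N ↦ V ‖x‖) (hu : MemHV V u)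
    (hv : MemHV V v) : MemHV V fun x ↦ u x - v x where
  memD12 := hu.memD12.sub hv.memD12
  energy_lt_top := (potentialEnergy_lt_top_iff hV (hu.memD12.sub hv.memD12).aemeasurable).2 <|
    ((potentialEnergy_lt_top_iff hV hu.memD12.aemeasurable).1 hu.energy_lt_top).sub
      ((potentialEnergy_lt_top_iff hV hv.memD12.aemeasurable).1 hv.energy_lt_top)

theorem MemHV.const_mul (hV : AEMeasurable fun x : Space N ↦ V ‖x‖) (hu : MemHV V u) (c : ℝ) :
    MemHV V fun x ↦ c * u x where
  memD12 := hu.memD12.const_mul c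
  energy_lt_top := (potentialEnergy_lt_top_iff hV (hu.memD12.const_mul c).aemeasurable).2 <|
    ((potentialEnergy_lt_top_iff hV hu.memD12.aemeasurable).1 hu.energy_lt_top).const_mul c

theorem IsRadialTest.memHV (hφ : IsRadialTest V φ) : MemHV V φ where
  memD12 :=
    { memLp := hφ.contDiff.continuous.memLp_of_hasCompactSupport hφ.hasCompactSupport
      exists_grad := ⟨_, hasWeakGradient_gradient hφ.contDiff⟩
      memLp_grad :=
        (memLp_congr_ae (hasWeakGradient_gradient hφ.contDiff).weakGrad_ae_eq).2 <|
          (continuous_gradient hφ.contDiff).memLp_of_hasCompactSupport <|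
            (hφ.hasCompactSupport.fderiv (𝕜 := ℝ)).comp_left (map_zero _) }
  energy_lt_top := hφ.energy_lt_top

theorem IsRadialTest.sub (hV : AEMeasurable fun x : Space N ↦ V ‖x‖) (hφ : IsRadialTest V φ)
    (hψ : IsRadialTest V ψ) : IsRadialTest V fun x ↦ φ x - ψ x where
  contDiff := hφ.contDiff.sub hψ.contDiff
  hasCompactSupport := hφ.hasCompactSupport.sub hψ.hasCompactSupport
  radial x y hxy := by rw [hφ.radial x y hxy, hψ.radial x y hxy]
  energy_lt_top := (hφ.memHV.sub hV hψ.memHV).energy_lt_top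

theorem IsRadialTest.const_mul (hV : AEMeasurable fun x : Space N ↦ V ‖x‖)
    (hφ : IsRadialTest V φ) (c : ℝ) : IsRadialTest V fun x ↦ c * φ x where
  contDiff := contDiff_const.mul hφ.contDiff
  hasCompactSupport := hφ.hasCompactSupport.mul_left
  radial x y hxy := by rw [hφ.radial x y hxy]
  energy_lt_top := (hφ.memHV.const_mul hV c).energy_lt_top

theorem MemHVr.sub (hV : AEMeasurable fun x : Space N ↦ V ‖x‖) (hu : MemHVr V u)
    (hv : MemHVr V v) : MemHVr V fun x ↦ u x - v x where
  memHV := hu.memHV.sub hV hv.memHV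
  mem_closure ε hε := by
    obtain ⟨φ, hφ, hφu⟩ := hu.mem_closure _ (ENNReal.half_pos hε.ne')
    obtain ⟨ψ, hψ, hψv⟩ := hv.mem_closure _ (ENNReal.half_pos hε.ne')
    refine ⟨_, hφ.sub hV hψ, ?_⟩
    calc normHV V (fun x ↦ u x - v x - (φ x - ψ x))
        = normHV V (fun x ↦ u x - φ x - (v x - ψ x)) := by simp only [sub_sub_sub_comm]
      _ ≤ normHV V (fun x ↦ u x - φ x) + normHV V (fun x ↦ v x - ψ x) :=
        normHV_sub_le hV (hu.memHV.memD12.sub hφ.memHV.memD12)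
          (hv.memHV.memD12.sub hψ.memHV.memD12)
      _ < ε / 2 + ε / 2 := ENNReal.add_lt_add hφu hψv
      _ = ε := ENNReal.add_halves ε

theorem MemHVr.const_mul (hV : AEMeasurable fun x : Space N ↦ V ‖x‖) (hu : MemHVr V u) (c : ℝ) :
    MemHVr V fun x ↦ c * u x where
  memHV := hu.memHV.const_mul hV c
  mem_closure ε hε := by
    obtain ⟨φ, hφ, hφu⟩ := hu.mem_closure (ε / (‖c‖ₑ + 1)) (ENNReal.div_pos hε.ne' (by simp))
    refine ⟨_, hφ.const_mul hV c, ?_⟩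
    simp only [← mul_sub]
    rw [normHV_const_mul hV (hu.memHV.memD12.sub hφ.memHV.memD12)]
    calc ‖c‖ₑ * normHV V (fun x ↦ u x - φ x)
        ≤ (‖c‖ₑ + 1) * normHV V (fun x ↦ u x - φ x) := by gcongr; exact le_self_add
      _ < (‖c‖ₑ + 1) * (ε / (‖c‖ₑ + 1)) :=
        (ENNReal.mul_lt_mul_iff_right (by simp) (by simp)).2 hφu
      _ ≤ ε := ENNReal.mul_div_le

end EnergySpace

section RadialEstimates

theorem rpow_half_sq (a : ℝ≥0∞) : (a ^ (1 / 2 : ℝ)) ^ 2 = a := by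
  rw [← ENNReal.rpow_two, ← ENNReal.rpow_mul, one_div_mul_cancel two_ne_zero, ENNReal.rpow_one]

theorem lintegral_mul_sq_le {α : Type*} [MeasurableSpace α] {μ : Measure α} {f g : α → ℝ≥0∞}
    (hf : AEMeasurable f μ) (hg : AEMeasurable g μ) :
    (∫⁻ x, f x * g x ∂μ) ^ 2 ≤ (∫⁻ x, f x ^ 2 ∂μ) * ∫⁻ x, g x ^ 2 ∂μ := by
  calc (∫⁻ x, f x * g x ∂μ) ^ 2
      ≤ ((∫⁻ x, f x ^ (2 : ℝ) ∂μ) ^ (1 / 2 : ℝ) * (∫⁻ x, g x ^ (2 : ℝ) ∂μ) ^ (1 / 2 : ℝ)) ^ 2 := by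
        gcongr
        exact ENNReal.lintegral_mul_le_Lp_mul_Lq μ Real.HolderConjugate.two_two hf hg
    _ = _ := by simp only [mul_pow, rpow_half_sq, ENNReal.rpow_two]

theorem lintegral_sq_le_weighted {α : Type*} [MeasurableSpace α] {μ : Measure α}
    {w g : α → ℝ≥0∞} (hw : AEMeasurable w μ) (hg : AEMeasurable g μ)
    (hw0 : ∀ᵐ x ∂μ, w x ≠ 0) (hw_top : ∀ᵐ x ∂μ, w x ≠ ⊤) :
    (∫⁻ x, g x ∂μ) ^ 2 ≤ (∫⁻ x, w x * g x ^ 2 ∂μ) * ∫⁻ x, (w x)⁻¹ ∂μ := by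
  have hsplit : ∫⁻ x, g x ∂μ = ∫⁻ x, w x ^ (1 / 2 : ℝ) * g x * w x ^ (-(1 / 2) : ℝ) ∂μ := by
    refine lintegral_congr_ae ?_
    filter_upwards [hw0, hw_top] with x hx0 hx_top
    rw [mul_right_comm, ← ENNReal.rpow_add _ _ hx0 hx_top, add_neg_cancel, ENNReal.rpow_zero,
      one_mul]
  rw [hsplit]
  refine (lintegral_mul_sq_le ((hw.pow_const _).mul hg) (hw.pow_const _)).trans_eq ?_
  simp only [Pi.mul_apply, mul_pow, ENNReal.rpow_neg, ← ENNReal.inv_pow, rpow_half_sq]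

theorem sq_sub_le_mul_integral_inv_pow {f : ℝ → ℝ} (hf : ContDiff ℝ 1 f) {n : ℕ} {C : ℝ≥0}
    (hC : ∫⁻ r in Set.Ioi (0 : ℝ), ENNReal.ofReal (r ^ n) * ‖deriv f r‖ₑ ^ 2 ≤ C) {a b : ℝ}
    (ha : 0 < a) (hab : a ≤ b) : (f b - f a) ^ 2 ≤ C * ∫ r in a..b, (r ^ n)⁻¹ := by
  have hd : Continuous (deriv f) := hf.continuous_deriv le_rfl
  have hpos : ∀ᵐ r ∂volume.restrict (Set.Ioc a b), 0 < r :=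
    (ae_restrict_mem measurableSet_Ioc).mono fun r hr ↦ ha.trans hr.1
  have hftc : ‖f b - f a‖ₑ ≤ ∫⁻ r in Set.Ioc a b, ‖deriv f r‖ₑ := by
    rw [← intervalIntegral.integral_deriv_eq_sub (fun x _ ↦ hf.differentiable (by simp) x)
      (hd.intervalIntegrable _ _), intervalIntegral.integral_of_le hab]
    exact enorm_integral_le_lintegral_enorm _
  have hinv_cont : ContinuousOn (fun r : ℝ ↦ (r ^ n)⁻¹) (Set.uIcc a b) := by
    rw [Set.uIcc_of_le hab]
    exact (by fun_prop : Continuous fun r : ℝ ↦ r ^ n).continuousOn.inv₀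
      fun r hr ↦ (pow_pos (ha.trans_le hr.1) n).ne'
  have hinv : ∫⁻ r in Set.Ioc a b, (ENNReal.ofReal (r ^ n))⁻¹ =
      ENNReal.ofReal (∫ r in a..b, (r ^ n)⁻¹) := by
    rw [intervalIntegral.integral_of_le hab, ofReal_integral_eq_lintegral_ofReal
      ((intervalIntegrable_iff_integrableOn_Ioc_of_le hab).1 hinv_cont.intervalIntegrable)
      (hpos.mono fun r hr ↦ by positivity)]
    exact lintegral_congr_ae (hpos.mono fun r hr ↦ (ENNReal.ofReal_inv_of_pos (by positivity)).symm)
  have hsq : ‖f b - f a‖ₑ ^ 2 ≤ C * ENNReal.ofReal (∫ r in a..b, (r ^ n)⁻¹) := by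
    refine (pow_le_pow_left' hftc 2).trans <| (lintegral_sq_le_weighted
      (w := fun r ↦ ENNReal.ofReal (r ^ n)) (by fun_prop) hd.measurable.enorm.aemeasurable
      (hpos.mono fun r hr ↦ (ENNReal.ofReal_pos.2 (by positivity)).ne')
      (.of_forall fun _ ↦ ENNReal.ofReal_ne_top)).trans ?_
    rw [hinv]
    gcongr
    exact (lintegral_mono_set fun r hr ↦ ha.trans hr.1).trans hC
  have hnonneg : 0 ≤ ∫ r in a..b, (r ^ n)⁻¹ :=
    intervalIntegral.integral_nonneg hab fun r hr ↦ by have := ha.trans_le hr.1; positivity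
  rwa [← ofReal_norm, ← ENNReal.ofReal_pow (norm_nonneg _), Real.norm_eq_abs, sq_abs,
    ← ENNReal.ofReal_coe_nnreal, ← ENNReal.ofReal_mul C.coe_nonneg,
    ENNReal.ofReal_le_ofReal_iff (by positivity)] at hsq

theorem integral_inv_pow_le_mul_sub (n : ℕ) {a b : ℝ} (ha : 0 < a) (hab : a ≤ b) :
    ∫ r in a..b, (r ^ n)⁻¹ ≤ (a ^ n)⁻¹ * (b - a) := by
  refine (Real.le_norm_self _).trans ?_
  rw [← abs_of_nonneg (sub_nonneg.2 hab)]
  refine intervalIntegral.norm_integral_le_of_norm_le_const fun r hr ↦ ?_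
  rw [Set.uIoc_of_le hab] at hr
  have hr0 : 0 < r := ha.trans hr.1
  rw [Real.norm_of_nonneg (by positivity)]
  gcongr
  exact hr.1.le

theorem integral_inv_pow_le {n : ℕ} {a b : ℝ} (hn : 2 ≤ n) (ha : 0 < a) (hab : a ≤ b) :
    ∫ r in a..b, (r ^ n)⁻¹ ≤ (a ^ (n - 1))⁻¹ := by
  have h0 : (0 : ℝ) ∉ Set.uIcc a b := by
    rw [Set.uIcc_of_le hab]
    exact fun h ↦ absurd h.1 (not_le.2 ha)
  have hval := integral_zpow (a := a) (b := b) (n := -(n : ℤ)) (.inr ⟨by omega, h0⟩)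
  rw [show -(n : ℤ) + 1 = -((n - 1 : ℕ) : ℤ) by omega] at hval
  simp only [zpow_neg, zpow_natCast] at hval
  have hn' : (2 : ℝ) ≤ n := mod_cast hn
  have hA : 0 < (a ^ (n - 1))⁻¹ := by positivity
  have hB : 0 < (b ^ (n - 1))⁻¹ := by have := ha.trans_le hab; positivity
  rw [hval, div_le_iff_of_neg (by push_cast; linarith)]
  push_cast
  nlinarith

/-- The decay bound `|f(a)|² ≤ C a^{2-N}` and the Hölder bound
`|f(b) - f(a)|² ≤ C a^{1-N} (b - a)`, which hold for the profile of a radial function on `ℝ^N`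
with `∫ |∇u|²` at most `C` times the area of the unit sphere. -/
structure RadialBound (N : ℕ) (f : ℝ → ℝ) (C : ℝ≥0) : Prop where
  decay : ∀ a : ℝ, 0 < a → f a ^ 2 ≤ C * (a ^ (N - 2))⁻¹
  holder : ∀ a b : ℝ, 0 < a → a ≤ b → (f b - f a) ^ 2 ≤ C * ((a ^ (N - 1))⁻¹ * (b - a))

theorem radialBound_of_lintegral_deriv_le {N : ℕ} (hN : 3 ≤ N) {f : ℝ → ℝ}
    (hf : ContDiff ℝ 1 f) (hzero : ∀ᶠ r in atTop, f r = 0) {C : ℝ≥0}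
    (hC : ∫⁻ r in Set.Ioi (0 : ℝ), ENNReal.ofReal (r ^ (N - 1)) * ‖deriv f r‖ₑ ^ 2 ≤ C) :
    RadialBound N f C where
  decay a ha := by
    obtain ⟨b, hb, hab⟩ := (hzero.and (eventually_ge_atTop a)).exists
    calc f a ^ 2 = (f b - f a) ^ 2 := by rw [hb, zero_sub, neg_sq]
      _ ≤ C * ∫ r in a..b, (r ^ (N - 1))⁻¹ := sq_sub_le_mul_integral_inv_pow hf hC ha hab
      _ ≤ C * (a ^ (N - 2))⁻¹ := by
        gcongr
        exact integral_inv_pow_le (by omega) ha hab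
  holder a b ha hab :=
    (sq_sub_le_mul_integral_inv_pow hf hC ha hab).trans <|
      mul_le_mul_of_nonneg_left (integral_inv_pow_le_mul_sub _ ha hab) C.2

variable {N : ℕ} [NeZero N] {V : ℝ → ℝ≥0∞} {φ : Space N → ℝ}

/-- The function `f` such that `φ x = f ‖x‖` for a radial function `φ`, read off along the first
coordinate axis. -/
def profile (φ : Space N → ℝ) (r : ℝ) : ℝ := φ (r • EuclideanSpace.single 0 1)

theorem IsRadialTest.profile_norm (hφ : IsRadialTest V φ) (x : Space N) : profile φ ‖x‖ = φ x :=
  hφ.radial _ _ (by simp [norm_smul])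

theorem IsRadialTest.profile_eq_comp_smul (hφ : IsRadialTest V φ) {e : Space N} (he : ‖e‖ = 1) :
    profile φ = fun t ↦ φ (t • e) :=
  funext fun t ↦ hφ.radial _ _ (by simp [norm_smul, he])

theorem IsRadialTest.contDiff_profile (hφ : IsRadialTest V φ) : ContDiff ℝ 1 (profile φ) :=
  (hφ.contDiff.of_le (by simp)).comp (contDiff_id.smul contDiff_const)

theorem IsRadialTest.eventually_profile_eq_zero (hφ : IsRadialTest V φ) :
    ∀ᶠ r in atTop, profile φ r = 0 := by
  obtain ⟨R, hR⟩ := hφ.hasCompactSupport.isCompact.isBounded.subset_closedBall 0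
  filter_upwards [eventually_gt_atTop R] with r hr
  by_contra hne
  have := hR (subset_tsupport φ hne)
  simp only [mem_closedBall_zero_iff, norm_smul, PiLp.norm_single, norm_one, mul_one,
    Real.norm_eq_abs] at this
  linarith [le_abs_self r]

theorem IsRadialTest.enorm_deriv_profile_le (hφ : IsRadialTest V φ) {x : Space N} (hx : x ≠ 0) :
    ‖deriv (profile φ) ‖x‖‖ₑ ≤ ‖gradient φ x‖ₑ := by
  set e := ‖x‖⁻¹ • x with he
  have he1 : ‖e‖ = 1 := by simp [he, norm_smul, hx]
  have hex : ‖x‖ • e = x := by simp [he, smul_smul, hx]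
  have hφx : HasFDerivAt φ (fderiv ℝ φ x) (‖x‖ • e) := by
    rw [hex]
    exact (hφ.contDiff.differentiable (by simp) x).hasFDerivAt
  have hderiv : deriv (fun t : ℝ ↦ φ (t • e)) ‖x‖ = inner ℝ (gradient φ x) e := by
    rw [inner_gradient_left]
    simpa [Function.comp_def] using
      (hφx.comp_hasDerivAt ‖x‖ ((hasDerivAt_id ‖x‖).smul_const e)).deriv
  rw [hφ.profile_eq_comp_smul he1, hderiv, enorm_le_iff_norm_le]
  simpa [he1] using norm_inner_le_norm (𝕜 := ℝ) (gradient φ x) e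

/-- The area of the unit sphere of `ℝ^N`, the constant in polar coordinates. -/
def sphereArea (N : ℕ) : ℝ≥0 := ((volume : Measure (Space N)).toSphere Set.univ).toNNReal

theorem coe_sphereArea (N : ℕ) :
    (sphereArea N : ℝ≥0∞) = (volume : Measure (Space N)).toSphere Set.univ :=
  ENNReal.coe_toNNReal (measure_ne_top _ _)

theorem sphereArea_ne_zero : sphereArea N ≠ 0 := by
  rw [← ENNReal.coe_ne_zero, coe_sphereArea, Ne, Measure.measure_univ_eq_zero]
  exact Measure.toSphere_ne_zero _

theorem IsRadialTest.sphereArea_mul_lintegral_deriv_profile_le (hφ : IsRadialTest V φ) :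
    sphereArea N * (∫⁻ r in Set.Ioi (0 : ℝ),
      ENNReal.ofReal (r ^ (N - 1)) * ‖deriv (profile φ) r‖ₑ ^ 2) ≤
        eLpNorm (weakGrad φ) 2 ^ 2 := by
  have hmeas : Measurable fun r ↦ ‖deriv (profile φ) r‖ₑ ^ 2 :=
    (hφ.contDiff_profile.continuous_deriv le_rfl).measurable.enorm.pow_const 2
  have hpolar := lintegral_fun_norm_addHaar (volume : Measure (Space N)) hmeas
  rw [← coe_sphereArea, finrank_euclideanSpace_fin] at hpolar
  rw [← hpolar, ← ENNReal.rpow_two, ← lintegral_enorm_sq_eq_eLpNorm_sq]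
  refine lintegral_mono_ae ?_
  filter_upwards [(hasWeakGradient_gradient hφ.contDiff).weakGrad_ae_eq,
    Measure.ae_ne volume (0 : Space N)] with x hx hx0
  rw [hx]
  gcongr
  exact hφ.enorm_deriv_profile_le hx0

/-- The constant in the bounds for the profile of a radial function `u` with
`∫ |∇u|² ≤ M²`. -/
def decayConst (N : ℕ) (M : ℝ≥0) : ℝ≥0 := M ^ 2 / sphereArea N

theorem IsRadialTest.radialBound_profile (hN : 3 ≤ N) (hφ : IsRadialTest V φ) {M : ℝ≥0}
    (hM : eLpNorm (weakGrad φ) 2 ≤ M) : RadialBound N (profile φ) (decayConst N M) := by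
  refine radialBound_of_lintegral_deriv_le hN hφ.contDiff_profile hφ.eventually_profile_eq_zero ?_
  rw [decayConst, ENNReal.coe_div sphereArea_ne_zero, ENNReal.le_div_iff_mul_le
    (.inl (ENNReal.coe_ne_zero.2 sphereArea_ne_zero)) (.inl ENNReal.coe_ne_top), mul_comm,
    ENNReal.coe_pow]
  exact hφ.sphereArea_mul_lintegral_deriv_profile_le.trans (pow_le_pow_left' hM 2)

end RadialEstimates

section RadialRepresentative

theorem locallyIntegrable_inv_norm_pow {E : Type*} [NormedAddCommGroup E] [NormedSpace ℝ E]
    [FiniteDimensional ℝ E] [MeasurableSpace E] [BorelSpace E] (μ : Measure E)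
    [μ.IsAddHaarMeasure] {n : ℕ} (hn : n < Module.finrank ℝ E) :
    LocallyIntegrable (fun x : E ↦ (‖x‖ ^ n)⁻¹) μ :=
  locallyIntegrable_of_norm_le_rpow (C := 1) (α := n) (by omega) (mod_cast hn)
    (.of_forall fun x ↦ by simp [Real.rpow_neg]) (by fun_prop)

theorem eq_zero_of_memLp_of_sub_ae_eq_const {X F : Type*} [TopologicalSpace X] [MeasurableSpace X]
    [NormedAddCommGroup F] {μ : Measure X} [IsFiniteMeasureOnCompacts μ] (hμ : μ Set.univ = ⊤)
    {p : ℝ≥0∞} (hp0 : p ≠ 0) (hp : p ≠ ⊤) {u w : X → F} {c : F} (hu : MemLp u p μ)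
    (hw : Tendsto w (cocompact X) (𝓝 0)) (hc : ∀ᵐ x ∂μ, u x - w x = c) : c = 0 := by
  by_contra hne
  have hc0 : 0 < ‖c‖ / 2 := by positivity
  have hsmall : ∀ᶠ x in cocompact X, ‖w x‖ < ‖c‖ / 2 := by
    simpa using hw.norm.eventually_lt_const (by simpa using hc0)
  obtain ⟨k, hk, hkw⟩ := mem_cocompact.1 hsmall
  have hsub : kᶜ ≤ᵐ[μ] {x | ENNReal.ofReal (‖c‖ / 2) ≤ ‖u x‖₊} := by
    filter_upwards [hc] with x hx hxk
    change ENNReal.ofReal (‖c‖ / 2) ≤ ‖u x‖ₑ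
    rw [← ofReal_norm]
    refine ENNReal.ofReal_le_ofReal ?_
    have htri : ‖c‖ ≤ ‖u x‖ + ‖w x‖ := hx ▸ norm_sub_le _ _
    have hwx : ‖w x‖ < ‖c‖ / 2 := hkw hxk
    linarith
  have hcompl : μ kᶜ < ⊤ := (measure_mono_ae hsub).trans_lt
    (hu.meas_ge_lt_top' hp0 hp (ENNReal.ofReal_pos.2 hc0).ne')
  refine (measure_union_lt_top hk.measure_lt_top hcompl).ne ?_
  rw [Set.union_compl_self, hμ]

section Limits

variable {N : ℕ} {u : Space N → ℝ} {g : Space N → Space N} {φ : Space N → ℝ}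

theorem HasWeakGradient.enorm_integral_mul_fderiv_le (hu : HasWeakGradient u g)
    (hφ : ContDiff ℝ ∞ φ) (hc : HasCompactSupport φ) (e : Space N) :
    ‖∫ x, u x * fderiv ℝ φ x e‖ₑ ≤ eLpNorm φ 2 * eLpNorm g 2 * ‖e‖ₑ := by
  rw [hu.integral_eq φ hφ hc e, enorm_neg]
  calc ‖∫ x, inner ℝ (g x) e * φ x‖ₑ ≤ ∫⁻ x, ‖inner ℝ (g x) e * φ x‖ₑ :=
        enorm_integral_le_lintegral_enorm _
    _ ≤ ∫⁻ x, ‖φ x • g x‖ₑ * ‖e‖ₑ := by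
        refine lintegral_mono fun x ↦ ?_
        rw [mul_comm, ← real_inner_smul_left]
        exact (ENNReal.coe_le_coe.2 (nnnorm_inner_le_nnnorm (φ x • g x) e)).trans_eq
          (ENNReal.coe_mul _ _)
    _ = eLpNorm (φ • g) 1 volume * ‖e‖ₑ := by
        rw [lintegral_mul_const' _ _ enorm_ne_top, eLpNorm_one_eq_lintegral_enorm]
        rfl
    _ ≤ eLpNorm φ 2 volume * eLpNorm g 2 volume * ‖e‖ₑ := by
        refine mul_le_mul' ?_ le_rfl
        exact eLpNorm_smul_le_mul_eLpNorm hu.locallyIntegrable_grad.aestronglyMeasurable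
          hφ.continuous.aestronglyMeasurable

theorem hasWeakGradient_zero_of_tendsto {w : ℕ → Space N → ℝ} {G : ℕ → Space N → Space N}
    (hw : ∀ n, HasWeakGradient (w n) (G n))
    (hG : Tendsto (fun n ↦ eLpNorm (G n) 2) atTop (𝓝 0)) {h : Space N → ℝ}
    (hh : LocallyIntegrable h) (hwh : ∀ n, ∀ᵐ x, ‖w n x‖ ≤ h x)
    (hlim : ∀ᵐ x, Tendsto (fun n ↦ w n x) atTop (𝓝 (u x))) :
    HasWeakGradient u fun _ ↦ 0 where
  locallyIntegrable := by
    refine hh.mono (aestronglyMeasurable_of_tendsto_ae atTop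
      (fun n ↦ (hw n).locallyIntegrable.aestronglyMeasurable) hlim) ?_
    filter_upwards [hlim, ae_all_iff.2 hwh] with x hx hxh
    exact le_of_tendsto' hx.norm fun n ↦ (hxh n).trans (Real.le_norm_self _)
  locallyIntegrable_grad := locallyIntegrable_zero
  integral_eq φ hφ hc e := by
    simp only [inner_zero_left, zero_mul, integral_zero, neg_zero]
    have hzero : Tendsto (fun n ↦ ∫ x, w n x * fderiv ℝ φ x e) atTop (𝓝 0) := by
      rw [tendsto_zero_iff_enorm_tendsto_zero]
      have hφ2 : eLpNorm φ 2 ≠ ⊤ := (hφ.continuous.memLp_of_hasCompactSupport hc).2.ne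
      have hbound : Tendsto (fun n ↦ eLpNorm φ 2 * eLpNorm (G n) 2 * ‖e‖ₑ) atTop (𝓝 0) := by
        simpa using ENNReal.Tendsto.mul_const (b := ‖e‖ₑ)
          (ENNReal.Tendsto.const_mul hG (.inr hφ2)) (.inr enorm_ne_top)
      exact tendsto_of_tendsto_of_tendsto_of_le_of_le tendsto_const_nhds hbound
        (fun _ ↦ zero_le) fun n ↦ (hw n).enorm_integral_mul_fderiv_le hφ hc e
    refine tendsto_nhds_unique (tendsto_integral_of_dominated_convergence
      (fun x ↦ ‖h x * fderiv ℝ φ x e‖)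
      (fun n ↦ (integrable_mul_fderiv_of_hasCompactSupport
        (hw n).locallyIntegrable hφ hc e).aestronglyMeasurable)
      (integrable_mul_fderiv_of_hasCompactSupport hh hφ hc e).norm (fun n ↦ ?_) ?_) hzero
    · filter_upwards [hwh n] with x hx
      rw [norm_mul, norm_mul]
      gcongr
      exact hx.trans (Real.le_norm_self _)
    · filter_upwards [hlim] with x hx
      exact hx.mul_const _

end Limits

section RadialBound

variable {N : ℕ} {f : ℝ → ℝ} {C : ℝ≥0}

theorem RadialBound.of_tendsto {ι : Type*} {l : Filter ι} [l.NeBot] {F : ι → ℝ → ℝ} {G : ι → ℝ≥0}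
    (hF : ∀ i, RadialBound N (F i) (G i)) (hG : Tendsto G l (𝓝 C))
    (hlim : ∀ a, 0 < a → Tendsto (fun i ↦ F i a) l (𝓝 (f a))) : RadialBound N f C where
  decay a ha := le_of_tendsto_of_tendsto' ((hlim a ha).pow 2)
    ((NNReal.tendsto_coe.2 hG).mul_const _) fun i ↦ (hF i).decay a ha
  holder a b ha hab := le_of_tendsto_of_tendsto'
    (((hlim b (ha.trans_le hab)).sub (hlim a ha)).pow 2)
    ((NNReal.tendsto_coe.2 hG).mul_const _) fun i ↦ (hF i).holder a b ha hab

theorem RadialBound.mono {C' : ℝ≥0} (hf : RadialBound N f C) (hC : C ≤ C') :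
    RadialBound N f C' where
  decay a ha := (hf.decay a ha).trans (by gcongr)
  holder a b ha hab := (hf.holder a b ha hab).trans <|
    mul_le_mul_of_nonneg_right hC (mul_nonneg (by positivity) (sub_nonneg.2 hab))

theorem RadialBound.norm_le_sqrt (hf : RadialBound N f C) {a : ℝ} (ha : 0 < a) :
    ‖f a‖ ≤ √(C * (a ^ (N - 2))⁻¹) :=
  Real.abs_le_sqrt (hf.decay a ha)

theorem RadialBound.norm_le_one_add (hf : RadialBound N f C) {a : ℝ} (ha : 0 < a) :
    ‖f a‖ ≤ 1 + C * (a ^ (N - 2))⁻¹ := by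
  have h := hf.decay a ha
  rw [Real.norm_eq_abs]
  nlinarith [sq_nonneg (|f a| - 1), sq_abs (f a)]

theorem RadialBound.tendsto_atTop (hN : 3 ≤ N) (hf : RadialBound N f C) :
    Tendsto f atTop (𝓝 0) := by
  refine squeeze_zero_norm' ((eventually_gt_atTop 0).mono fun a ha ↦ hf.norm_le_sqrt ha) ?_
  have hpow : Tendsto (fun a : ℝ ↦ (a ^ (N - 2))⁻¹) atTop (𝓝 0) :=
    tendsto_inv_atTop_zero.comp (tendsto_pow_atTop (by omega))
  simpa using (hpow.const_mul (C : ℝ)).sqrt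

end RadialBound

variable {N : ℕ} {V : ℝ → ℝ≥0∞} {u : Space N → ℝ}

theorem decayConst_mono : Monotone (decayConst N) := fun _ _ h ↦ by
  unfold decayConst
  gcongr

theorem continuous_decayConst : Continuous (decayConst N) := by
  unfold decayConst
  fun_prop

theorem critExp_pos (hN : 3 ≤ N) : 0 < critExp N := by
  have : (3 : ℝ) ≤ N := mod_cast hN
  exact div_pos (by linarith) (by linarith)

theorem MemHVr.exists_seq_isRadialTest (hu : MemHVr V u) :
    ∃ (φ : ℕ → Space N → ℝ) (δ : ℕ → ℝ≥0), (∀ n, IsRadialTest V (φ n)) ∧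
      (∀ n, normHV V (fun x ↦ u x - φ n x) ≤ δ n) ∧ Antitone δ ∧ Tendsto δ atTop (𝓝 0) := by
  obtain ⟨δ, hδ, hδ_pos, hδ0⟩ := exists_seq_strictAnti_tendsto (0 : ℝ≥0)
  choose φ hφ hφu using fun n ↦ hu.mem_closure (δ n) (by simpa using hδ_pos n)
  exact ⟨φ, δ, hφ, fun n ↦ (hφu n).le, hδ.antitone, hδ0⟩

variable [NeZero N]

theorem IsRadialTest.radialBound_profile_of_normHV_le (hN : 3 ≤ N) {φ : Space N → ℝ}
    (hφ : IsRadialTest V φ) {M : ℝ≥0} (hM : normHV V φ ≤ M) :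
    RadialBound N (profile φ) (decayConst N M) :=
  hφ.radialBound_profile hN ((eLpNorm_weakGrad_le_normHV V φ).trans hM)

theorem tendsto_profile_of_normHV_sub_le (hN : 3 ≤ N) (hV : AEMeasurable fun x : Space N ↦ V ‖x‖)
    (hu : MemD12 u) {φ : ℕ → Space N → ℝ} (hφ : ∀ n, IsRadialTest V (φ n)) {δ : ℕ → ℝ≥0}
    (hφu : ∀ n, normHV V (fun x ↦ u x - φ n x) ≤ δ n) (hδ : Antitone δ)
    (hδ0 : Tendsto δ atTop (𝓝 0)) {a : ℝ} (ha : 0 < a) :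
    ∃ y, Tendsto (fun n ↦ profile (φ n) a) atTop (𝓝 y) := by
  have hsub (m n : ℕ) : normHV V (fun x ↦ φ m x - φ n x) ≤ (δ n + δ m : ℝ≥0) := by
    have hD (k) : MemD12 fun x ↦ u x - φ k x := hu.sub (hφ k).memHV.memD12
    calc normHV V (fun x ↦ φ m x - φ n x)
        = normHV V (fun x ↦ (u x - φ n x) - (u x - φ m x)) := by
          simp only [sub_sub_sub_cancel_left]
      _ ≤ δ n + δ m := (normHV_sub_le hV (hD n) (hD m)).trans (add_le_add (hφu n) (hφu m))
  refine cauchySeq_tendsto_of_complete <| cauchySeq_of_le_tendsto_0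
    (fun k ↦ √(decayConst N (δ k + δ k) * (a ^ (N - 2))⁻¹)) (fun m n k hm hn ↦ ?_) ?_
  · have hbound := ((hφ m).sub hV (hφ n)).radialBound_profile_of_normHV_le hN (hsub m n)
    exact (hbound.mono (decayConst_mono (add_le_add (hδ hn) (hδ hm)))).norm_le_sqrt ha
  · have hC : Tendsto (fun k ↦ decayConst N (δ k + δ k)) atTop (𝓝 0) := by
      simpa [Function.comp_def, decayConst] using
        (continuous_decayConst.tendsto (0 + 0)).comp (hδ0.add hδ0)
    simpa using ((NNReal.tendsto_coe.2 hC).mul_const (a ^ (N - 2))⁻¹).sqrt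

theorem ae_eq_fun_norm_of_tendsto_profile (hN : 3 ≤ N) (hu : MemD12 u) {φ : ℕ → Space N → ℝ}
    (hφ : ∀ n, IsRadialTest V (φ n))
    (hφu : Tendsto (fun n ↦ normHV V fun x ↦ u x - φ n x) atTop (𝓝 0)) {f : ℝ → ℝ} {C : ℝ≥0}
    (hφC : ∀ n, RadialBound N (profile (φ n)) C) (hf : RadialBound N f C)
    (hlim : ∀ a, 0 < a → Tendsto (fun n ↦ profile (φ n) a) atTop (𝓝 (f a))) :
    ∀ᵐ x, u x = f ‖x‖ := by
  have hzero : HasWeakGradient (fun x ↦ u x - f ‖x‖) fun _ ↦ 0 := by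
    have hmajorant : LocallyIntegrable fun x ↦ ‖u x‖ + (1 + C * (‖x‖ ^ (N - 2))⁻¹) :=
      (hu.hasWeakGradient.locallyIntegrable.mono hu.memLp.1.norm (by simp)).add <|
        (locallyIntegrable_const 1).add <| (locallyIntegrable_inv_norm_pow volume
          (by rw [finrank_euclideanSpace_fin]; omega)).smul (C : ℝ)
    refine hasWeakGradient_zero_of_tendsto
      (fun n ↦ (hu.sub (hφ n).memHV.memD12).hasWeakGradient)
      (tendsto_of_tendsto_of_tendsto_of_le_of_le tendsto_const_nhds hφu (fun _ ↦ zero_le)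
        fun n ↦ eLpNorm_weakGrad_le_normHV V _) hmajorant (fun n ↦ ?_) ?_
    · filter_upwards [Measure.ae_ne volume (0 : Space N)] with x hx
      refine (norm_sub_le _ _).trans ?_
      rw [← (hφ n).profile_norm x]
      gcongr
      exact (hφC n).norm_le_one_add (norm_pos_iff.2 hx)
    · filter_upwards [Measure.ae_ne volume (0 : Space N)] with x hx
      refine tendsto_const_nhds.sub ?_
      simpa only [(hφ _).profile_norm] using hlim ‖x‖ (norm_pos_iff.2 hx)
  obtain ⟨c, hc⟩ := ae_eq_const_of_hasWeakGradient_zero hzero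
  have hc0 : c = 0 := eq_zero_of_memLp_of_sub_ae_eq_const
    (measure_univ_of_isAddLeftInvariant volume) (by simpa using critExp_pos hN)
    ENNReal.ofReal_ne_top hu.memLp ((hf.tendsto_atTop hN).comp tendsto_norm_cocompact_atTop) hc
  filter_upwards [hc] with x hx
  exact sub_eq_zero.1 (hx.trans hc0)

theorem MemHVr.exists_radial_repr (hN : 3 ≤ N) (hV : AEMeasurable fun x : Space N ↦ V ‖x‖)
    (hu : MemHVr V u) {M : ℝ≥0} (hM : normHV V u ≤ M) :
    ∃ f : ℝ → ℝ, (∀ᵐ x, u x = f ‖x‖) ∧ RadialBound N f (decayConst N M) := by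
  have hD := hu.memHV.memD12
  obtain ⟨φ, δ, hφ, hφu, hδ, hδ0⟩ := hu.exists_seq_isRadialTest
  choose! f hlim using fun a (ha : 0 < a) ↦
    tendsto_profile_of_normHV_sub_le hN hV hD hφ hφu hδ hδ0 ha
  have hφ_bound (n) : RadialBound N (profile (φ n)) (decayConst N (M + δ n)) := by
    refine (hφ n).radialBound_profile_of_normHV_le hN ?_
    calc normHV V (φ n) = normHV V (fun x ↦ u x - (u x - φ n x)) := by simp only [sub_sub_cancel]
      _ ≤ normHV V u + normHV V (fun x ↦ u x - φ n x) :=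
          normHV_sub_le hV hD (hD.sub (hφ n).memHV.memD12)
      _ ≤ M + δ n := add_le_add hM (hφu n)
  have hf : RadialBound N f (decayConst N M) := by
    refine .of_tendsto hφ_bound ?_ hlim
    simpa [Function.comp_def] using
      (continuous_decayConst.tendsto (M + 0)).comp (hδ0.const_add M)
  have hφu0 : Tendsto (fun n ↦ normHV V fun x ↦ u x - φ n x) atTop (𝓝 0) :=
    tendsto_of_tendsto_of_tendsto_of_le_of_le tendsto_const_nhds (ENNReal.tendsto_coe.2 hδ0)
      (fun _ ↦ zero_le) hφu
  exact ⟨f, ae_eq_fun_norm_of_tendsto_profile hN hD hφ hφu0 (C := decayConst N (M + δ 0))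
    (fun n ↦ (hφ_bound n).mono (decayConst_mono (add_le_add_right (hδ n.zero_le) M)))
    (hf.mono (decayConst_mono le_self_add)) hlim, hf⟩

end RadialRepresentative

section PointwiseConsequences

theorem exists_subseq_tendsto_of_equicontinuous {X F : Type*} [TopologicalSpace X]
    [TopologicalSpace.SeparableSpace X] [PseudoMetricSpace F] [ProperSpace F] {f : ℕ → X → F}
    (hf : Equicontinuous f) (hb : ∀ x, Bornology.IsBounded (Set.range fun n ↦ f n x)) :
    ∃ k : ℕ → ℕ, StrictMono k ∧ ∃ g : X → F, Tendsto (fun n ↦ f (k n)) atTop (𝓝 g) := by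
  obtain ⟨D, hD, hDd⟩ := TopologicalSpace.exists_countable_dense X
  have : Countable D := hD
  obtain ⟨w, -, k, hk, hw⟩ := (isCompact_univ_pi fun x : D ↦
    (hb x).isCompact_closure).tendsto_subseq (x := fun n (x : D) ↦ f n x)
      fun n x _ ↦ subset_closure (Set.mem_range_self n)
  have hcauchy (x : X) : CauchySeq fun n ↦ f (k n) x := by
    refine Metric.cauchySeq_iff'.2 fun ε hε ↦ ?_
    obtain ⟨y, hy, hyD⟩ := hDd.inter_nhds_nonempty
      (Metric.equicontinuousAt_iff_right.1 (hf x) (ε / 3) (by positivity))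
    obtain ⟨n₀, hn₀⟩ := Metric.cauchySeq_iff'.1
      (tendsto_pi_nhds.1 hw ⟨y, hy⟩).cauchySeq (ε / 3) (by positivity)
    refine ⟨n₀, fun n hn ↦ ?_⟩
    have hfar : dist (f (k n) y) (f (k n₀) y) < ε / 3 := hn₀ n hn
    have hclose (m : ℕ) : dist (f m x) (f m y) < ε / 3 := hyD m
    calc dist (f (k n) x) (f (k n₀) x)
        ≤ dist (f (k n) x) (f (k n) y) + dist (f (k n) y) (f (k n₀) y)
          + dist (f (k n₀) y) (f (k n₀) x) := dist_triangle4 ..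
      _ < ε := by linarith [hclose (k n), dist_comm (f (k n₀) y) (f (k n₀) x), hclose (k n₀)]
  choose g hg using fun x ↦ cauchySeq_tendsto_of_complete (hcauchy x)
  exact ⟨k, hk, g, tendsto_pi_nhds.2 hg⟩

variable {N : ℕ} {f : ℝ → ℝ} {C : ℝ≥0}

theorem RadialBound.dist_le (hf : RadialBound N f C) {a b : ℝ} (ha : 0 < a) (hb : 0 < b) :
    dist (f a) (f b) ≤ √(C * ((min a b ^ (N - 1))⁻¹ * dist a b)) := by
  wlog hab : a ≤ b generalizing a b
  · rw [dist_comm, min_comm, dist_comm a]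
    exact this hb ha (le_of_not_ge hab)
  rw [min_eq_left hab, dist_comm, dist_comm a, Real.dist_eq b,
    abs_of_nonneg (sub_nonneg.2 hab)]
  exact Real.abs_le_sqrt (hf.holder a b ha hab)

theorem exists_subseq_tendsto_of_radialBound {f : ℕ → ℝ → ℝ} (hf : ∀ n, RadialBound N (f n) C) :
    ∃ k : ℕ → ℕ, StrictMono k ∧ ∃ g : ℝ → ℝ, ∀ a, 0 < a →
      Tendsto (fun n ↦ f (k n) a) atTop (𝓝 (g a)) := by
  have hequi : Equicontinuous fun n (a : Set.Ioi (0 : ℝ)) ↦ f n a := fun a ↦ by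
    refine Metric.equicontinuousAt_of_continuity_modulus
      (fun b : Set.Ioi (0 : ℝ) ↦ √(C * ((min a b ^ (N - 1) : ℝ)⁻¹ * dist (a : ℝ) b))) ?_ _
      (.of_forall fun b n ↦ (hf n).dist_le a.2 b.2)
    have hcont : ContinuousAt
        (fun b : Set.Ioi (0 : ℝ) ↦ √(C * ((min a b ^ (N - 1) : ℝ)⁻¹ * dist (a : ℝ) b))) a := by
      have hne : (min a a ^ (N - 1) : ℝ) ≠ 0 := by
        simpa using pow_ne_zero (N - 1) (Set.mem_Ioi.1 a.2).ne'
      fun_prop (disch := exact hne)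
    simpa [ContinuousAt] using hcont
  have hbdd (a : Set.Ioi (0 : ℝ)) : Bornology.IsBounded (Set.range fun n ↦ f n a) :=
    isBounded_iff_forall_norm_le.2 ⟨_, Set.forall_mem_range.2 fun n ↦ (hf n).norm_le_sqrt a.2⟩
  obtain ⟨k, hk, g, hg⟩ := exists_subseq_tendsto_of_equicontinuous hequi hbdd
  rw [tendsto_pi_nhds] at hg
  choose! g' hg' using fun (a : ℝ) (ha : 0 < a) ↦ (⟨g ⟨a, ha⟩, hg ⟨a, ha⟩⟩ :
    ∃ y, Tendsto (fun n ↦ f (k n) a) atTop (𝓝 y))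
  exact ⟨k, hk, g', hg'⟩

variable [NeZero N] {V : ℝ → ℝ≥0∞} {M : ℝ≥0}

theorem MemHVr.ae_norm_le (hN : 3 ≤ N) (hV : AEMeasurable fun x : Space N ↦ V ‖x‖)
    {u : Space N → ℝ} (hu : MemHVr V u) (hM : normHV V u ≤ M) {a : ℝ} (ha : 0 < a) :
    ∀ᵐ x, a ≤ ‖x‖ → ‖u x‖ ≤ √(decayConst N M * (a ^ (N - 2))⁻¹) := by
  obtain ⟨f, hf, hb⟩ := hu.exists_radial_repr hN hV hM
  filter_upwards [hf] with x hx hax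
  rw [hx]
  refine (hb.norm_le_sqrt (ha.trans_le hax)).trans ?_
  gcongr

theorem MemHVr.ae_eq_zero (hN : 3 ≤ N) (hV : AEMeasurable fun x : Space N ↦ V ‖x‖)
    {u : Space N → ℝ} (hu : MemHVr V u) (h0 : normHV V u = 0) : ∀ᵐ x, u x = 0 := by
  obtain ⟨f, hf, hb⟩ := hu.exists_radial_repr hN hV (M := 0) (by simp [h0])
  filter_upwards [hf, Measure.ae_ne volume 0] with x hx hx0
  simpa [hx, decayConst] using hb.norm_le_sqrt (norm_pos_iff.2 hx0)

theorem exists_subseq_ae_tendsto (hN : 3 ≤ N) (hV : AEMeasurable fun x : Space N ↦ V ‖x‖)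
    {u : ℕ → Space N → ℝ} (hu : ∀ n, MemHVr V (u n)) (hM : ∀ n, normHV V (u n) ≤ M) :
    ∃ k : ℕ → ℕ, StrictMono k ∧ ∃ w : Space N → ℝ, ∀ᵐ x,
      Tendsto (fun n ↦ u (k n) x) atTop (𝓝 (w x)) := by
  choose f hf hb using fun n ↦ (hu n).exists_radial_repr hN hV (hM n)
  obtain ⟨k, hk, g, hg⟩ := exists_subseq_tendsto_of_radialBound hb
  refine ⟨k, hk, fun x ↦ g ‖x‖, ?_⟩
  filter_upwards [ae_all_iff.2 hf, Measure.ae_ne volume 0] with x hx hx0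
  simpa only [hx] using hg ‖x‖ (norm_pos_iff.2 hx0)

end PointwiseConsequences

section SupOn

variable {N : ℕ} {V : ℝ → ℝ≥0∞} {K : ℝ → ℝ} {q : ℝ} {A B : Set (Space N)} {u : Space N → ℝ}

/-- The supremum of `∫_A K(|x|) |u|^q dx` over the unit sphere of `H^1_{V,r}`: the common form of
`Szero` (for `A` a ball) and `Sinfty` (for `A` the complement of a ball). -/
def supOn (V : ℝ → ℝ≥0∞) (K : ℝ → ℝ) (q : ℝ) (A : Set (Space N)) : ℝ≥0∞ :=
  ⨆ (u : Space N → ℝ) (_ : MemHVr V u) (_ : normHV V u = 1),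
    ∫⁻ x in A, ENNReal.ofReal (K ‖x‖) * ‖u x‖ₑ ^ q

theorem supOn_le_iff {c : ℝ≥0∞} : supOn V K q A ≤ c ↔ ∀ u, MemHVr V u → normHV V u = 1 →
    ∫⁻ x in A, ENNReal.ofReal (K ‖x‖) * ‖u x‖ₑ ^ q ≤ c := by
  simp only [supOn, iSup_le_iff]

theorem le_supOn (hu : MemHVr V u) (h1 : normHV V u = 1) :
    ∫⁻ x in A, ENNReal.ofReal (K ‖x‖) * ‖u x‖ₑ ^ q ≤ supOn V K q A :=
  supOn_le_iff.1 le_rfl u hu h1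

theorem supOn_mono (h : A ⊆ B) : supOn V K q A ≤ supOn V K q B :=
  supOn_le_iff.2 fun _ hu h1 ↦ (lintegral_mono_set h).trans (le_supOn hu h1)

theorem supOn_union_le (A B : Set (Space N)) :
    supOn V K q (A ∪ B) ≤ supOn V K q A + supOn V K q B :=
  supOn_le_iff.2 fun _ hu h1 ↦ (lintegral_union_le _ _ _).trans
    (add_le_add (le_supOn hu h1) (le_supOn hu h1))

variable [NeZero N]

theorem MemHVr.lintegral_le_supOn (hN : 3 ≤ N) (hV : AEMeasurable fun x : Space N ↦ V ‖x‖)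
    (hK : LocallyIntegrableOn K (Set.Ioi 0)) (hq : 0 < q) (hA : MeasurableSet A)
    (hu : MemHVr V u) :
    ∫⁻ x in A, ‖u x‖ₑ ^ q ∂weightMeasure N K ≤ supOn V K q A * normHV V u ^ q := by
  rcases eq_or_ne (normHV V u) 0 with h0 | h0
  · rw [lintegral_eq_zero_of_ae_eq_zero]
    · exact zero_le
    filter_upwards [ae_restrict_of_ae (weightMeasure_absolutelyContinuous.ae_le
      (hu.ae_eq_zero hN hV h0))] with x hx
    simp [hx, hq]
  have hT := hu.memHV.normHV_ne_top
  set c : ℝ := (normHV V u).toReal⁻¹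
  have hc : ‖c‖ₑ = (normHV V u)⁻¹ := by
    have hpos : 0 < (normHV V u).toReal := ENNReal.toReal_pos h0 hT
    rw [Real.enorm_of_nonneg (by positivity), ENNReal.ofReal_inv_of_pos hpos,
      ENNReal.ofReal_toReal hT]
  have h1 : normHV V (fun x ↦ c * u x) = 1 := by
    rw [normHV_const_mul hV hu.memHV.memD12, hc, ENNReal.inv_mul_cancel h0 hT]
  calc ∫⁻ x in A, ‖u x‖ₑ ^ q ∂weightMeasure N K
      = (∫⁻ x in A, ‖c * u x‖ₑ ^ q ∂weightMeasure N K) * normHV V u ^ q := by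
        simp_rw [enorm_mul, ENNReal.mul_rpow_of_nonneg _ _ hq.le, hc]
        rw [lintegral_const_mul' _ _ (by finiteness), mul_right_comm,
          ← ENNReal.mul_rpow_of_nonneg _ _ hq.le, ENNReal.inv_mul_cancel h0 hT, ENNReal.one_rpow,
          one_mul]
    _ ≤ supOn V K q A * normHV V u ^ q := by
        rw [setLIntegral_weightMeasure (aemeasurable_ofReal_fun_norm hK) hA]
        gcongr
        exact le_supOn (hu.const_mul hV c) h1

theorem weightMeasure_annulus_lt_top (hK : LocallyIntegrableOn K (Set.Ioi 0)) {a : ℝ}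
    (ha : 0 < a) (b : ℝ) : weightMeasure N K (Metric.ball 0 b \ Metric.ball 0 a) < ⊤ :=
  weightMeasure_lt_top_of_integrableOn (measurableSet_ball.diff measurableSet_ball)
    (integrableOn_fun_norm_annulus volume hK ha b)

theorem supOn_annulus_lt_top (hN : 3 ≤ N) (hV : AEMeasurable fun x : Space N ↦ V ‖x‖)
    (hK : LocallyIntegrableOn K (Set.Ioi 0)) (hq : 0 ≤ q) {a : ℝ} (ha : 0 < a) (b : ℝ) :
    supOn V K q (Metric.ball (0 : Space N) b \ Metric.ball 0 a) < ⊤ := by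
  have hmeas : MeasurableSet (Metric.ball (0 : Space N) b \ Metric.ball 0 a) :=
    measurableSet_ball.diff measurableSet_ball
  set c : ℝ := √(decayConst N 1 * (a ^ (N - 2))⁻¹)
  refine (supOn_le_iff.2 fun u hu h1 ↦ ?_).trans_lt (ENNReal.mul_lt_top
    (ENNReal.rpow_lt_top_of_nonneg hq (enorm_ne_top (x := c)))
    (weightMeasure_annulus_lt_top (N := N) hK ha b))
  rw [← setLIntegral_weightMeasure (aemeasurable_ofReal_fun_norm hK) hmeas, ← setLIntegral_const]
  refine lintegral_mono_ae ?_
  filter_upwards [ae_restrict_mem hmeas, ae_restrict_of_ae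
    (weightMeasure_absolutelyContinuous.ae_le (hu.ae_norm_le hN hV (M := 1) (by simp [h1]) ha))]
    with x hx hxu
  gcongr
  exact enorm_le_iff_norm_le.2 ((hxu (by simpa using hx.2)).trans (Real.le_norm_self c))

end SupOn

section SumSpace

theorem eLpNorm_ofReal_rpow {α F : Type*} [MeasurableSpace α] [NormedAddCommGroup F]
    {μ : Measure α} {q : ℝ} (hq : 0 < q) (u : α → F) :
    eLpNorm u (ENNReal.ofReal q) μ ^ q = ∫⁻ x, ‖u x‖ₑ ^ q ∂μ := by
  have h := eLpNorm_nnreal_pow_eq_lintegral (μ := μ) (f := u) (p := q.toNNReal) (by simpa using hq)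
  rwa [Real.coe_toNNReal q hq.le] at h

variable {N : ℕ} {K : ℝ → ℝ} {q₁ q₂ : ℝ} {u u₁ u₂ v v₁ v₂ : Space N → ℝ}

theorem IsDecomp.normSum_le (h : IsDecomp K q₁ q₂ u u₁ u₂) :
    normSum K q₁ q₂ u ≤ max (eLpNorm u₁ (ENNReal.ofReal q₁) (weightMeasure N K))
      (eLpNorm u₂ (ENNReal.ofReal q₂) (weightMeasure N K)) :=
  iInf_le_of_le u₁ (iInf_le_of_le u₂ (iInf_le_of_le h le_rfl))

theorem exists_isDecomp_of_normSum_lt {t : ℝ≥0∞} (h : normSum K q₁ q₂ u < t) :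
    ∃ u₁ u₂, IsDecomp K q₁ q₂ u u₁ u₂ ∧
      eLpNorm u₁ (ENNReal.ofReal q₁) (weightMeasure N K) < t ∧
      eLpNorm u₂ (ENNReal.ofReal q₂) (weightMeasure N K) < t := by
  simp only [normSum, iInf_lt_iff] at h
  obtain ⟨u₁, u₂, hd, hlt⟩ := h
  exact ⟨u₁, u₂, hd, max_lt_iff.1 hlt⟩

theorem IsDecomp.sub (hu : IsDecomp K q₁ q₂ u u₁ u₂) (hv : IsDecomp K q₁ q₂ v v₁ v₂) :
    IsDecomp K q₁ q₂ (fun x ↦ u x - v x) (u₁ - v₁) (u₂ - v₂) where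
  left := hu.left.sub hv.left
  right := hu.right.sub hv.right
  add_eq := by
    filter_upwards [hu.add_eq, hv.add_eq] with x hx hy
    rw [hx, hy, Pi.sub_apply, Pi.sub_apply, add_sub_add_comm]

theorem MemSum.sub (hu : MemSum K q₁ q₂ u) (hv : MemSum K q₁ q₂ v) :
    MemSum K q₁ q₂ fun x ↦ u x - v x :=
  have ⟨_, _, hu'⟩ := hu
  have ⟨_, _, hv'⟩ := hv
  ⟨_, _, hu'.sub hv'⟩

/-- The constant of the quasi-triangle inequality in `L^{q₁}_K + L^{q₂}_K`; it is `1` when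
`q₁, q₂ ≥ 1`. -/
def sumAddConst (q₁ q₂ : ℝ) : ℝ≥0∞ :=
  max (ENNReal.ofReal q₁).LpAddConst (ENNReal.ofReal q₂).LpAddConst

theorem sumAddConst_ne_top : sumAddConst q₁ q₂ ≠ ⊤ :=
  (max_lt (ENNReal.LpAddConst_lt_top _) (ENNReal.LpAddConst_lt_top _)).ne

theorem normSum_sub_le_of_lt {s t : ℝ≥0∞} (hu : normSum K q₁ q₂ u < s)
    (hv : normSum K q₁ q₂ v < t) :
    normSum K q₁ q₂ (fun x ↦ u x - v x) ≤ sumAddConst q₁ q₂ * (s + t) := by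
  obtain ⟨u₁, u₂, hud, hu₁, hu₂⟩ := exists_isDecomp_of_normSum_lt hu
  obtain ⟨v₁, v₂, hvd, hv₁, hv₂⟩ := exists_isDecomp_of_normSum_lt hv
  refine (hud.sub hvd).normSum_le.trans (max_le ?_ ?_)
  · exact (eLpNorm_sub_le' hud.left.1 hvd.left.1 _).trans
      (mul_le_mul' (le_max_left _ _) (add_le_add hu₁.le hv₁.le))
  · exact (eLpNorm_sub_le' hud.right.1 hvd.right.1 _).trans
      (mul_le_mul' (le_max_right _ _) (add_le_add hu₂.le hv₂.le))

variable {A : Set (Space N)}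

theorem isDecomp_indicator (hq₁ : 0 < q₁) (hq₂ : 0 < q₂) (hA : MeasurableSet A)
    (hu : AEStronglyMeasurable u) (h₁ : ∫⁻ x in A, ‖u x‖ₑ ^ q₁ ∂weightMeasure N K < ⊤)
    (h₂ : ∫⁻ x in Aᶜ, ‖u x‖ₑ ^ q₂ ∂weightMeasure N K < ⊤) :
    IsDecomp K q₁ q₂ u (A.indicator u) (Aᶜ.indicator u) := by
  have hmem {B : Set (Space N)} (hB : MeasurableSet B) {q : ℝ} (hq : 0 < q)
      (h : ∫⁻ x in B, ‖u x‖ₑ ^ q ∂weightMeasure N K < ⊤) :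
      MemLp (B.indicator u) (ENNReal.ofReal q) (weightMeasure N K) := by
    refine ⟨(hu.mono_ac weightMeasure_absolutelyContinuous).indicator hB, ?_⟩
    rw [eLpNorm_indicator_eq_eLpNorm_restrict hB, ← ENNReal.rpow_lt_top_iff_of_pos hq,
      eLpNorm_ofReal_rpow hq]
    exact h
  exact ⟨hmem hA hq₁ h₁, hmem hA.compl hq₂ h₂,
    .of_forall fun x ↦ (congrFun (Set.indicator_self_add_compl A u) x).symm⟩

theorem normSum_le_of_setLIntegral_le (hq₁ : 0 < q₁) (hq₂ : 0 < q₂) (hA : MeasurableSet A)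
    (hu : AEStronglyMeasurable u) {t : ℝ≥0∞}
    (h₁ : ∫⁻ x in A, ‖u x‖ₑ ^ q₁ ∂weightMeasure N K ≤ t ^ q₁)
    (h₂ : ∫⁻ x in Aᶜ, ‖u x‖ₑ ^ q₂ ∂weightMeasure N K ≤ t ^ q₂) : normSum K q₁ q₂ u ≤ t := by
  rcases eq_or_ne t ⊤ with rfl | ht
  · exact le_top
  refine (isDecomp_indicator hq₁ hq₂ hA hu
    (h₁.trans_lt (ENNReal.rpow_lt_top_of_nonneg hq₁.le ht))
    (h₂.trans_lt (ENNReal.rpow_lt_top_of_nonneg hq₂.le ht))).normSum_le.trans (max_le ?_ ?_)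
  · rwa [eLpNorm_indicator_eq_eLpNorm_restrict hA, ← ENNReal.rpow_le_rpow_iff hq₁,
      eLpNorm_ofReal_rpow hq₁]
  · rwa [eLpNorm_indicator_eq_eLpNorm_restrict hA.compl, ← ENNReal.rpow_le_rpow_iff hq₂,
      eLpNorm_ofReal_rpow hq₂]

end SumSpace

section Sufficiency

variable {N : ℕ} [NeZero N] {V : ℝ → ℝ≥0∞} {K : ℝ → ℝ} {q q₁ q₂ : ℝ}

theorem supOn_compl_ball_lt_top (hN : 3 ≤ N) (hV : AEMeasurable fun x : Space N ↦ V ‖x‖)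
    (hK : LocallyIntegrableOn K (Set.Ioi 0)) (hq : 0 ≤ q) {a b : ℝ} (ha : 0 < a)
    (h : supOn V K q (Metric.ball (0 : Space N) b)ᶜ < ⊤) :
    supOn V K q (Metric.ball (0 : Space N) a)ᶜ < ⊤ := by
  have hsub : (Metric.ball (0 : Space N) a)ᶜ ⊆
      (Metric.ball 0 b)ᶜ ∪ (Metric.ball 0 b \ Metric.ball 0 a) :=
    fun _ hx ↦ (em _).symm.imp_right (⟨·, hx⟩)
  exact (supOn_mono hsub).trans_lt ((supOn_union_le _ _).trans_lt
    (ENNReal.add_lt_top.2 ⟨h, supOn_annulus_lt_top hN hV hK hq ha b⟩))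

theorem continuouslyEmbedded_of_condFinite (hN : 3 ≤ N)
    (hV : AEMeasurable fun x : Space N ↦ V ‖x‖) (hK : LocallyIntegrableOn K (Set.Ioi 0))
    (hq₁ : 0 < q₁) (hq₂ : 0 < q₂) (h : CondFinite N V K q₁ q₂) :
    ContinuouslyEmbedded N V K q₁ q₂ := by
  obtain ⟨R, R₂, hR, -, h₁, h₂⟩ := h
  set S₁ := supOn V K q₁ (Metric.ball (0 : Space N) R)
  set S₂ := supOn V K q₂ (Metric.ball (0 : Space N) R)ᶜ
  have hS₁ : S₁ ≠ ⊤ := h₁.ne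
  have hS₂ : S₂ ≠ ⊤ := (supOn_compl_ball_lt_top hN hV hK hq₂.le hR h₂).ne
  set C : ℝ≥0∞ := max (S₁ ^ q₁⁻¹) (S₂ ^ q₂⁻¹)
  have hC : C ≠ ⊤ := (max_lt (by finiteness) (by finiteness)).ne
  refine ⟨C.toNNReal, fun u hu ↦ ?_⟩
  have hT := hu.memHV.normHV_ne_top
  have bound {q : ℝ} (hq : 0 < q) {B : Set (Space N)} (hB : MeasurableSet B)
      (hSC : supOn V K q B ^ q⁻¹ ≤ C) :
      ∫⁻ x in B, ‖u x‖ₑ ^ q ∂weightMeasure N K ≤ (C * normHV V u) ^ q := by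
    rw [ENNReal.mul_rpow_of_nonneg _ _ hq.le]
    refine (hu.lintegral_le_supOn hN hV hK hq hB).trans ?_
    gcongr
    rwa [← ENNReal.rpow_inv_le_iff hq]
  have b₁ := bound hq₁ (measurableSet_ball (x := 0) (ε := R)) (le_max_left _ _)
  have b₂ := bound hq₂ (measurableSet_ball (x := 0) (ε := R)).compl (le_max_right _ _)
  have hu' := hu.memHV.memD12.memLp.1
  rw [ENNReal.coe_toNNReal hC]
  exact ⟨⟨_, _, isDecomp_indicator hq₁ hq₂ measurableSet_ball hu'
    (b₁.trans_lt (by finiteness)) (b₂.trans_lt (by finiteness))⟩,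
    normSum_le_of_setLIntegral_le hq₁ hq₂ measurableSet_ball hu' b₁ b₂⟩

variable {M : ℝ≥0} {v : ℕ → Space N → ℝ} {w : Space N → ℝ}

theorem lintegral_le_supOn_of_ae_tendsto (hN : 3 ≤ N)
    (hV : AEMeasurable fun x : Space N ↦ V ‖x‖) (hK : LocallyIntegrableOn K (Set.Ioi 0))
    (hq : 0 < q) (hv : ∀ m, MemHVr V (v m)) (hM : ∀ m, normHV V (v m) ≤ M)
    (hw : ∀ᵐ x, Tendsto (fun m ↦ v m x) atTop (𝓝 (w x))) {B : Set (Space N)}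
    (hB : MeasurableSet B) :
    ∫⁻ x in B, ‖w x‖ₑ ^ q ∂weightMeasure N K ≤ supOn V K q B * M ^ q := by
  have hac : weightMeasure N K ≪ volume := weightMeasure_absolutelyContinuous
  calc ∫⁻ x in B, ‖w x‖ₑ ^ q ∂weightMeasure N K
      = ∫⁻ x in B, liminf (fun m ↦ ‖v m x‖ₑ ^ q) atTop ∂weightMeasure N K := by
        refine lintegral_congr_ae (ae_restrict_of_ae (hac.ae_le ?_))
        filter_upwards [hw] with x hx
        exact (hx.enorm.ennrpow_const q).liminf_eq.symm
    _ ≤ liminf (fun m ↦ ∫⁻ x in B, ‖v m x‖ₑ ^ q ∂weightMeasure N K) atTop :=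
        lintegral_liminf_le' fun m ↦
          (((hv m).memHV.memD12.memLp.1.enorm.pow_const q).mono_ac hac).restrict
    _ ≤ supOn V K q B * M ^ q := by
        refine liminf_le_of_frequently_le' (.of_forall fun m ↦ ?_)
        refine ((hv m).lintegral_le_supOn hN hV hK hq hB).trans ?_
        gcongr
        exact hM m

theorem ae_norm_le_of_ae_tendsto (hN : 3 ≤ N) (hV : AEMeasurable fun x : Space N ↦ V ‖x‖)
    (hv : ∀ m, MemHVr V (v m)) (hM : ∀ m, normHV V (v m) ≤ M)
    (hw : ∀ᵐ x, Tendsto (fun m ↦ v m x) atTop (𝓝 (w x))) {a : ℝ} (ha : 0 < a) :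
    ∀ᵐ x, a ≤ ‖x‖ → ‖w x‖ ≤ √(decayConst N M * (a ^ (N - 2))⁻¹) := by
  filter_upwards [hw, ae_all_iff.2 fun m ↦ (hv m).ae_norm_le hN hV (hM m) ha] with x hx hxm hax
  exact le_of_tendsto' hx.norm fun m ↦ hxm m hax

omit [NeZero N] in
theorem tendsto_setLIntegral_rpow_of_bounded {α : Type*} [MeasurableSpace α] {μ : Measure α}
    {A : Set α} (hA : μ A ≠ ⊤) (hq : 0 < q) {v : ℕ → α → ℝ}
    (hv : ∀ n, AEStronglyMeasurable (v n) μ) {c : ℝ} (hc : ∀ n, ∀ᵐ x ∂μ.restrict A, ‖v n x‖ ≤ c)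
    (hlim : ∀ᵐ x ∂μ, Tendsto (fun n ↦ v n x) atTop (𝓝 0)) :
    Tendsto (fun n ↦ ∫⁻ x in A, ‖v n x‖ₑ ^ q ∂μ) atTop (𝓝 0) := by
  rw [← lintegral_zero (μ := μ.restrict A)]
  refine tendsto_lintegral_of_dominated_convergence' (fun _ ↦ ‖c‖ₑ ^ q)
    (fun n ↦ ((hv n).enorm.pow_const q).restrict) (fun n ↦ ?_) ?_ ?_
  · filter_upwards [hc n] with x hx
    gcongr
    exact enorm_le_iff_norm_le.2 (hx.trans (Real.le_norm_self c))
  · rw [setLIntegral_const]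
    finiteness
  · filter_upwards [ae_restrict_of_ae hlim] with x hx
    simpa [hq] using hx.enorm.ennrpow_const q

theorem tendsto_setLIntegral_sub_of_tendsto_supOn {ι : Type*} {l : Filter ι} [NeBot l]
    (hN : 3 ≤ N) (hV : AEMeasurable fun x : Space N ↦ V ‖x‖)
    (hK : LocallyIntegrableOn K (Set.Ioi 0)) (hq : 0 < q) {u : ℕ → Space N → ℝ}
    (hu : ∀ n, MemHVr V (u n)) (hM : ∀ n, normHV V (u n) ≤ M)
    (hw : ∀ᵐ x, Tendsto (fun n ↦ u n x) atTop (𝓝 (w x))) {A : Set (Space N)}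
    {B : ι → Set (Space N)} (hB : ∀ i, MeasurableSet (B i))
    (hS : Tendsto (fun i ↦ supOn V K q (B i)) l (𝓝 0))
    (hAB : ∀ᶠ i in l, ∃ a b : ℝ, 0 < a ∧ A ⊆ B i ∪ (Metric.ball 0 b \ Metric.ball 0 a)) :
    Tendsto (fun n ↦ ∫⁻ x in A, ‖u n x - w x‖ₑ ^ q ∂weightMeasure N K) atTop (𝓝 0) := by
  have hdiff (n m) : MemHVr V fun x ↦ u n x - u m x := (hu n).sub hV (hu m)
  have hdiffM (n m) : normHV V (fun x ↦ u n x - u m x) ≤ (M + M : ℝ≥0) :=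
    (normHV_sub_le hV (hu n).memHV.memD12 (hu m).memHV.memD12).trans
      (by simpa using add_le_add (hM n) (hM m))
  have hlim (n) : ∀ᵐ x, Tendsto (fun m ↦ u n x - u m x) atTop (𝓝 (u n x - w x)) :=
    hw.mono fun x hx ↦ hx.const_sub (u n x)
  have hac : weightMeasure N K ≪ volume := weightMeasure_absolutelyContinuous
  have hwm : AEStronglyMeasurable w :=
    aestronglyMeasurable_of_tendsto_ae atTop (fun n ↦ (hu n).memHV.memD12.memLp.1) hw
  have hann {a : ℝ} (ha : 0 < a) (b : ℝ) : Tendsto (fun n ↦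
      ∫⁻ x in Metric.ball 0 b \ Metric.ball 0 a, ‖u n x - w x‖ₑ ^ q ∂weightMeasure N K)
      atTop (𝓝 0) := by
    refine tendsto_setLIntegral_rpow_of_bounded (weightMeasure_annulus_lt_top hK ha b).ne hq
      (c := √(decayConst N (M + M) * (a ^ (N - 2))⁻¹))
      (fun n ↦ ((hu n).memHV.memD12.memLp.1.sub hwm).mono_ac hac) (fun n ↦ ?_)
      (hac.ae_le (hw.mono fun x hx ↦ by simpa using hx.sub_const (w x)))
    filter_upwards [ae_restrict_mem (measurableSet_ball.diff measurableSet_ball),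
      ae_restrict_of_ae (hac.ae_le
        (ae_norm_le_of_ae_tendsto hN hV (hdiff n) (hdiffM n) (hlim n) ha))] with x hx hxb
    exact hxb (by simpa using hx.2)
  refine ENNReal.tendsto_nhds_zero.2 fun ε hε ↦ ?_
  have hε₂ : 0 < ε / 2 := ENNReal.half_pos hε.ne'
  have hS' : Tendsto (fun i ↦ supOn V K q (B i) * ((M + M : ℝ≥0) : ℝ≥0∞) ^ q) l (𝓝 0) := by
    simpa using ENNReal.Tendsto.mul_const hS (.inr (by finiteness))
  obtain ⟨i, hi, a, b, ha, hsub⟩ := ((ENNReal.tendsto_nhds_zero.1 hS' _ hε₂).and hAB).exists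
  filter_upwards [ENNReal.tendsto_nhds_zero.1 (hann ha b) _ hε₂] with n hn
  calc ∫⁻ x in A, ‖u n x - w x‖ₑ ^ q ∂weightMeasure N K
      ≤ ∫⁻ x in B i ∪ (Metric.ball 0 b \ Metric.ball 0 a), ‖u n x - w x‖ₑ ^ q
          ∂weightMeasure N K := lintegral_mono_set hsub
    _ ≤ ε / 2 + ε / 2 := (lintegral_union_le _ _ _).trans (add_le_add
        ((lintegral_le_supOn_of_ae_tendsto hN hV hK hq (hdiff n) (hdiffM n) (hlim n)
          (hB i)).trans hi) hn)
    _ = ε := ENNReal.add_halves ε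

omit [NeZero N] in
theorem CondVanishing.condFinite (h : CondVanishing N V K q₁ q₂) : CondFinite N V K q₁ q₂ := by
  obtain ⟨R₁, h₁, hR₁⟩ := ((h.1.eventually_lt_const ENNReal.zero_lt_top).and
    self_mem_nhdsWithin).exists
  obtain ⟨R₂, h₂, hR₂⟩ := ((h.2.eventually_lt_const ENNReal.zero_lt_top).and
    (eventually_gt_atTop 0)).exists
  exact ⟨R₁, R₂, hR₁, hR₂, h₁, h₂⟩

theorem compactlyEmbedded_of_condVanishing (hN : 3 ≤ N)
    (hV : AEMeasurable fun x : Space N ↦ V ‖x‖) (hK : LocallyIntegrableOn K (Set.Ioi 0))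
    (hq₁ : 0 < q₁) (hq₂ : 0 < q₂) (h : CondVanishing N V K q₁ q₂) :
    CompactlyEmbedded N V K q₁ q₂ := by
  have hce := continuouslyEmbedded_of_condFinite hN hV hK hq₁ hq₂ h.condFinite
  refine ⟨hce, fun u hu ⟨M, hM⟩ ↦ ?_⟩
  obtain ⟨k, hk, w, hw⟩ := exists_subseq_ae_tendsto hN hV hu hM
  have hin := tendsto_setLIntegral_sub_of_tendsto_supOn hN hV hK hq₁ (fun n ↦ hu (k n))
    (fun n ↦ hM (k n)) hw (A := Metric.ball 0 1) (fun R ↦ measurableSet_ball) h.1 <| by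
      filter_upwards [self_mem_nhdsWithin] with R hR
      exact ⟨R, 1, hR, by rw [Set.union_sdiff_self]; exact Set.subset_union_right⟩
  have hout := tendsto_setLIntegral_sub_of_tendsto_supOn hN hV hK hq₂ (fun n ↦ hu (k n))
    (fun n ↦ hM (k n)) hw (A := (Metric.ball 0 1)ᶜ) (fun R ↦ measurableSet_ball.compl) h.2 <|
      .of_forall fun R ↦ ⟨1, R, one_pos, fun _ hx ↦ (em _).symm.imp_right (⟨·, hx⟩)⟩
  have hm (n) : AEStronglyMeasurable fun x ↦ u (k n) x - w x :=
    (hu (k n)).memHV.memD12.memLp.1.sub (aestronglyMeasurable_of_tendsto_ae atTop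
      (fun n ↦ (hu (k n)).memHV.memD12.memLp.1) hw)
  refine ⟨w, ?_, k, hk, ENNReal.tendsto_nhds_zero.2 fun ε hε ↦ ?_⟩
  · obtain ⟨n, h₁, h₂⟩ := ((hin.eventually_lt_const ENNReal.zero_lt_top).and
      (hout.eventually_lt_const ENNReal.zero_lt_top)).exists
    obtain ⟨C, hC⟩ := hce
    simpa using (hC _ (hu (k n))).1.sub
      ⟨_, _, isDecomp_indicator hq₁ hq₂ measurableSet_ball (hm n) h₁ h₂⟩
  · rcases eq_or_ne ε ⊤ with rfl | hε'
    · simp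
    filter_upwards [ENNReal.tendsto_nhds_zero.1 hin _ (ENNReal.rpow_pos hε hε'),
      ENNReal.tendsto_nhds_zero.1 hout _ (ENNReal.rpow_pos hε hε')] with n h₁ h₂
    exact normSum_le_of_setLIntegral_le hq₁ hq₂ measurableSet_ball (hm n) h₁ h₂

end Sufficiency

section Necessity

theorem rpow_le_of_le_add {x a b M : ℝ≥0∞} {p q : ℝ} (hp : 0 ≤ p) (hpq : p ≤ q) (hx : x ≤ a + b)
    (hM : x ≤ M) : x ^ q ≤ M ^ (q - p) * 2 ^ p * a ^ p + 2 ^ q * b ^ q := by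
  have hq : 0 ≤ q := hp.trans hpq
  rcases le_total a b with h | h
  · refine le_add_of_le_right ?_
    rw [← ENNReal.mul_rpow_of_nonneg _ _ hq, two_mul]
    gcongr
    exact hx.trans (by gcongr)
  · refine le_add_of_le_left ?_
    rw [mul_assoc, ← ENNReal.mul_rpow_of_nonneg _ _ hp, two_mul]
    calc x ^ q = x ^ (q - p) * x ^ p := by
          rw [← ENNReal.rpow_add_of_nonneg _ _ (sub_nonneg.2 hpq) hp, sub_add_cancel]
      _ ≤ M ^ (q - p) * (a + a) ^ p := by
          gcongr
          exact hx.trans (by gcongr)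

theorem lintegral_rpow_le_of_le_add {α : Type*} [MeasurableSpace α] {μ : Measure α}
    {f g h : α → ℝ≥0∞} {M : ℝ≥0∞} {p q : ℝ} (hp : 0 ≤ p) (hpq : p ≤ q) (hg : AEMeasurable g μ)
    (hf : ∀ᵐ x ∂μ, f x ≤ g x + h x) (hM : ∀ᵐ x ∂μ, f x ≤ M) :
    ∫⁻ x, f x ^ q ∂μ ≤
      M ^ (q - p) * 2 ^ p * ∫⁻ x, g x ^ p ∂μ + 2 ^ q * ∫⁻ x, h x ^ q ∂μ := by
  rw [← lintegral_const_mul'' _ (hg.pow_const p), ← lintegral_const_mul' _ _ (by finiteness),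
    ← lintegral_add_left' ((hg.pow_const p).const_mul _)]
  refine lintegral_mono_ae ?_
  filter_upwards [hf, hM] with x hx hxM
  exact rpow_le_of_le_add hp hpq hx hxM

theorem setLIntegral_rpow_le_of_eLpNorm_le {α F : Type*} [MeasurableSpace α]
    [NormedAddCommGroup F] {μ : Measure α} {q : ℝ} (hq : 0 < q) {f : α → F} {t : ℝ≥0∞}
    (h : eLpNorm f (ENNReal.ofReal q) μ ≤ t) (A : Set α) :
    ∫⁻ x in A, ‖f x‖ₑ ^ q ∂μ ≤ t ^ q := by
  rw [← eLpNorm_ofReal_rpow hq]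
  gcongr
  exact (eLpNorm_restrict_le _ _ _ _).trans h

variable {N : ℕ} {V : ℝ → ℝ≥0∞} {K : ℝ → ℝ} {q q₁ q₂ : ℝ} {A : Set (Space N)}

theorem IsDecomp.ae_enorm_le {u a b : Space N → ℝ} (h : IsDecomp K q₁ q₂ u a b) :
    ∀ᵐ x ∂weightMeasure N K, ‖u x‖ₑ ≤ ‖a x‖ₑ + ‖b x‖ₑ := by
  filter_upwards [weightMeasure_absolutelyContinuous.ae_le h.add_eq] with x hx
  exact hx ▸ enorm_add_le _ _

theorem tendsto_normSum_sub {ι : Type*} {l : Filter ι} {u v : ι → Space N → ℝ}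
    (hu : Tendsto (fun i ↦ normSum K q₁ q₂ (u i)) l (𝓝 0))
    (hv : Tendsto (fun i ↦ normSum K q₁ q₂ (v i)) l (𝓝 0)) :
    Tendsto (fun i ↦ normSum K q₁ q₂ fun x ↦ u i x - v i x) l (𝓝 0) := by
  have hlim : Tendsto (fun t ↦ sumAddConst q₁ q₂ * (t + t)) (𝓝[>] 0) (𝓝 0) := by
    have h : Tendsto (fun t : ℝ≥0∞ ↦ t + t) (𝓝 0) (𝓝 0) := by
      simpa using (tendsto_id (x := 𝓝 (0 : ℝ≥0∞))).add tendsto_id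
    simpa using ENNReal.Tendsto.const_mul (h.mono_left nhdsWithin_le_nhds)
      (.inr sumAddConst_ne_top)
  refine ENNReal.tendsto_nhds_zero.2 fun ε hε ↦ ?_
  obtain ⟨t, htε, ht⟩ := ((ENNReal.tendsto_nhds_zero.1 hlim ε hε).and self_mem_nhdsWithin).exists
  filter_upwards [hu.eventually_lt_const ht, hv.eventually_lt_const ht] with i hui hvi
  exact (normSum_sub_le_of_lt hui hvi).trans htε

/-- On bounded subsets of `H^1_{V,r}`, the norm of `L^{q₁}_K + L^{q₂}_K` controls the norm of
`L^q_K(A)`. -/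
def SumControls (V : ℝ → ℝ≥0∞) (K : ℝ → ℝ) (q₁ q₂ q : ℝ) (A : Set (Space N)) : Prop :=
  ∀ M : ℝ≥0, ∃ c : ℝ≥0, ∀ v : Space N → ℝ, MemHVr V v → normHV V v ≤ M → ∀ t : ℝ≥0∞,
    normSum K q₁ q₂ v < t → ∫⁻ x in A, ‖v x‖ₑ ^ q ∂weightMeasure N K ≤ c * (t ^ q₁ + t ^ q₂)

theorem sumControls_of_measure_lt_top (hq₁ : 0 < q₁) (hq : q₁ ≤ q₂)
    (hA : weightMeasure N K A < ⊤) : SumControls V K q₁ q₂ q₁ A := by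
  intro M
  set m : ℝ≥0∞ := weightMeasure N K A ^ (1 / q₁ - 1 / q₂)
  have hm : m ≠ ⊤ := ENNReal.rpow_ne_top_of_nonneg
    (sub_nonneg.2 (one_div_le_one_div_of_le hq₁ hq)) hA.ne
  have hc : 2 ^ q₁ + 2 ^ q₁ * m ^ q₁ ≠ ⊤ := by finiteness
  refine ⟨(2 ^ q₁ + 2 ^ q₁ * m ^ q₁).toNNReal, fun v _ _ t ht ↦ ?_⟩
  obtain ⟨a, b, hd, ha, hb⟩ := exists_isDecomp_of_normSum_lt ht
  have hb' : ∫⁻ x in A, ‖b x‖ₑ ^ q₁ ∂weightMeasure N K ≤ (t * m) ^ q₁ := by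
    rw [← eLpNorm_ofReal_rpow hq₁]
    gcongr
    refine (eLpNorm_le_eLpNorm_mul_rpow_measure_univ (ENNReal.ofReal_le_ofReal hq)
      hd.right.1.restrict).trans ?_
    rw [ENNReal.toReal_ofReal hq₁.le, ENNReal.toReal_ofReal (hq₁.le.trans hq),
      Measure.restrict_apply_univ]
    gcongr
    exact (eLpNorm_restrict_le _ _ _ _).trans hb.le
  calc ∫⁻ x in A, ‖v x‖ₑ ^ q₁ ∂weightMeasure N K
      ≤ 2 ^ q₁ * ∫⁻ x in A, ‖a x‖ₑ ^ q₁ ∂weightMeasure N K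
        + 2 ^ q₁ * ∫⁻ x in A, ‖b x‖ₑ ^ q₁ ∂weightMeasure N K := by
        simpa using lintegral_rpow_le_of_le_add hq₁.le le_rfl hd.left.1.enorm.restrict
          (ae_restrict_of_ae hd.ae_enorm_le) (.of_forall fun _ ↦ le_top)
    _ ≤ 2 ^ q₁ * t ^ q₁ + 2 ^ q₁ * (t * m) ^ q₁ := by
        gcongr
        exact setLIntegral_rpow_le_of_eLpNorm_le hq₁ ha.le A
    _ = (2 ^ q₁ + 2 ^ q₁ * m ^ q₁) * t ^ q₁ := by
        rw [ENNReal.mul_rpow_of_nonneg _ _ hq₁.le]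
        ring
    _ ≤ _ := by
        rw [ENNReal.coe_toNNReal hc]
        gcongr
        exact le_self_add

theorem sumControls_compl_ball [NeZero N] (hN : 3 ≤ N)
    (hV : AEMeasurable fun x : Space N ↦ V ‖x‖) (hq₁ : 0 < q₁) (hq : q₁ ≤ q₂) {R : ℝ}
    (hR : 0 < R) : SumControls V K q₁ q₂ q₂ (Metric.ball (0 : Space N) R)ᶜ := by
  have hq₂ : 0 < q₂ := hq₁.trans_le hq
  intro M
  set L : ℝ := √(decayConst N M * (R ^ (N - 2))⁻¹)
  have hL : ‖L‖ₑ ^ (q₂ - q₁) * 2 ^ q₁ ≠ ⊤ :=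
    ENNReal.mul_ne_top (ENNReal.rpow_ne_top_of_nonneg (sub_nonneg.2 hq) enorm_ne_top)
      (by finiteness)
  have hc : ‖L‖ₑ ^ (q₂ - q₁) * 2 ^ q₁ + 2 ^ q₂ ≠ ⊤ := by finiteness
  refine ⟨(‖L‖ₑ ^ (q₂ - q₁) * 2 ^ q₁ + 2 ^ q₂).toNNReal, fun v hv hvM t ht ↦ ?_⟩
  obtain ⟨a, b, hd, ha, hb⟩ := exists_isDecomp_of_normSum_lt ht
  set μ := (weightMeasure N K).restrict (Metric.ball 0 R)ᶜ
  have hbound : ∀ᵐ x ∂μ, ‖v x‖ₑ ≤ ‖L‖ₑ := by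
    filter_upwards [ae_restrict_mem measurableSet_ball.compl,
      ae_restrict_of_ae (weightMeasure_absolutelyContinuous.ae_le
        (hv.ae_norm_le hN hV hvM hR))] with x hx hxL
    exact enorm_le_iff_norm_le.2 ((hxL (by simpa using hx)).trans (Real.le_norm_self L))
  calc ∫⁻ x, ‖v x‖ₑ ^ q₂ ∂μ
      ≤ ‖L‖ₑ ^ (q₂ - q₁) * 2 ^ q₁ * ∫⁻ x, ‖a x‖ₑ ^ q₁ ∂μ + 2 ^ q₂ * ∫⁻ x, ‖b x‖ₑ ^ q₂ ∂μ :=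
        lintegral_rpow_le_of_le_add hq₁.le hq hd.left.1.enorm.restrict
          (ae_restrict_of_ae hd.ae_enorm_le) hbound
    _ ≤ ‖L‖ₑ ^ (q₂ - q₁) * 2 ^ q₁ * t ^ q₁ + 2 ^ q₂ * t ^ q₂ := by
        gcongr
        exacts [setLIntegral_rpow_le_of_eLpNorm_le hq₁ ha.le _,
          setLIntegral_rpow_le_of_eLpNorm_le hq₂ hb.le _]
    _ ≤ _ := by
        rw [ENNReal.coe_toNNReal hc, mul_add]
        gcongr
        exacts [le_self_add, le_add_self]

theorem SumControls.tendsto (h : SumControls V K q₁ q₂ q A) (hq₁ : 0 < q₁) (hq₂ : 0 < q₂)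
    {ι : Type*} {l : Filter ι} {v : ι → Space N → ℝ} (hv : ∀ i, MemHVr V (v i)) {M : ℝ≥0}
    (hM : ∀ i, normHV V (v i) ≤ M) (hlim : Tendsto (fun i ↦ normSum K q₁ q₂ (v i)) l (𝓝 0)) :
    Tendsto (fun i ↦ ∫⁻ x in A, ‖v i x‖ₑ ^ q ∂weightMeasure N K) l (𝓝 0) := by
  obtain ⟨c, hc⟩ := h M
  have hlim₀ : Tendsto (fun t : ℝ≥0∞ ↦ c * (t ^ q₁ + t ^ q₂)) (𝓝[>] 0) (𝓝 0) := by
    have h : Tendsto (fun t : ℝ≥0∞ ↦ t ^ q₁ + t ^ q₂) (𝓝 0) (𝓝 0) := by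
      simpa [hq₁, hq₂] using ((tendsto_id (x := 𝓝 (0 : ℝ≥0∞))).ennrpow_const q₁).add
        (tendsto_id.ennrpow_const q₂)
    simpa using ENNReal.Tendsto.const_mul (h.mono_left nhdsWithin_le_nhds)
      (.inr (ENNReal.coe_ne_top (r := c)))
  refine ENNReal.tendsto_nhds_zero.2 fun ε hε ↦ ?_
  obtain ⟨t, htε, ht⟩ :=
    ((ENNReal.tendsto_nhds_zero.1 hlim₀ ε hε).and self_mem_nhdsWithin).exists
  filter_upwards [hlim.eventually_lt_const ht] with i hi
  exact (hc _ (hv i) (hM i) t hi).trans htε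

theorem tendsto_setLIntegral_of_eventually_notMem {α ι : Type*} [MeasurableSpace α]
    {μ : Measure α} {l : Filter ι} [l.IsCountablyGenerated] {f : α → ℝ≥0∞} {B : Set α}
    (hB : MeasurableSet B) (hf : ∫⁻ x in B, f x ∂μ ≠ ⊤) {A : ι → Set α}
    (hA : ∀ i, MeasurableSet (A i)) (hAB : ∀ᶠ i in l, A i ⊆ B)
    (hlim : ∀ᵐ x ∂μ, ∀ᶠ i in l, x ∉ A i) :
    Tendsto (fun i ↦ ∫⁻ x in A i, f x ∂μ) l (𝓝 0) := by
  simp_rw [← withDensity_apply f (hA _)]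
  rw [← measure_empty (μ := μ.withDensity f)]
  refine tendsto_measure_of_ae_tendsto_indicator l .empty hA hB
    (by rwa [withDensity_apply f hB]) hAB ?_
  filter_upwards [(withDensity_absolutelyContinuous μ f).ae_le hlim] with x hx
  simpa using hx

theorem SumControls.exists_subseq_tendsto_sub (h : SumControls V K q₁ q₂ q A) (hq₁ : 0 < q₁)
    (hq₂ : 0 < q₂) (hV : AEMeasurable fun x : Space N ↦ V ‖x‖)
    (hc : CompactlyEmbedded N V K q₁ q₂) {u : ℕ → Space N → ℝ} (hu : ∀ n, MemHVr V (u n))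
    {M : ℝ≥0} (hM : ∀ n, normHV V (u n) ≤ M) :
    ∃ k : ℕ → ℕ, StrictMono k ∧ Tendsto (fun p : ℕ × ℕ ↦
      ∫⁻ x in A, ‖u (k p.2) x - u (k p.1) x‖ₑ ^ q ∂weightMeasure N K)
      (atTop ×ˢ atTop) (𝓝 0) := by
  obtain ⟨w, -, k, hk, hw⟩ := hc.2 u hu ⟨M, hM⟩
  refine ⟨k, hk, h.tendsto hq₁ hq₂ (fun p ↦ (hu _).sub hV (hu _)) (M := M + M) (fun p ↦ ?_) ?_⟩
  · exact (normHV_sub_le hV (hu _).memHV.memD12 (hu _).memHV.memD12).trans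
      (by simpa using add_le_add (hM _) (hM _))
  · simpa using tendsto_normSum_sub (hw.comp tendsto_snd) (hw.comp tendsto_fst)

variable [NeZero N]

theorem SumControls.supOn_lt_top (h : SumControls V K q₁ q₂ q A) (hq₁ : 0 < q₁) (hq₂ : 0 < q₂)
    (hK : LocallyIntegrableOn K (Set.Ioi 0)) (hA : MeasurableSet A)
    (hc : ContinuouslyEmbedded N V K q₁ q₂) : supOn V K q A < ⊤ := by
  obtain ⟨C, hC⟩ := hc
  obtain ⟨c, hc⟩ := h 1
  refine (supOn_le_iff (c := c * ((C + 1) ^ q₁ + (C + 1) ^ q₂)).2 fun u hu h1 ↦ ?_).trans_lt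
    (ENNReal.mul_lt_top ENNReal.coe_lt_top (ENNReal.add_lt_top.2
      ⟨ENNReal.rpow_lt_top_of_nonneg hq₁.le (by finiteness),
        ENNReal.rpow_lt_top_of_nonneg hq₂.le (by finiteness)⟩))
  rw [← setLIntegral_weightMeasure (aemeasurable_ofReal_fun_norm hK) hA]
  refine hc u hu (by simp [h1]) _ ((hC u hu).2.trans_lt ?_)
  rw [h1, mul_one]
  exact ENNReal.lt_add_right ENNReal.coe_ne_top one_ne_zero

theorem exists_lt_of_lt_supOn (hK : LocallyIntegrableOn K (Set.Ioi 0)) (hA : MeasurableSet A)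
    {ε : ℝ≥0∞} (h : ε < supOn V K q A) : ∃ u, MemHVr V u ∧ normHV V u = 1 ∧
      ε < ∫⁻ x in A, ‖u x‖ₑ ^ q ∂weightMeasure N K := by
  simpa only [setLIntegral_weightMeasure (aemeasurable_ofReal_fun_norm hK) hA, supOn, lt_iSup_iff,
    exists_prop] using h

theorem SumControls.tendsto_supOn {B : Set (Space N)} (h : SumControls V K q₁ q₂ q B)
    (hq₁ : 0 < q₁) (hq₂ : 0 < q₂) (hq : 0 < q) (hN : 3 ≤ N)
    (hV : AEMeasurable fun x : Space N ↦ V ‖x‖) (hK : LocallyIntegrableOn K (Set.Ioi 0))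
    (hc : CompactlyEmbedded N V K q₁ q₂) (hB : MeasurableSet B) {ι : Type*} {l : Filter ι}
    [l.IsCountablyGenerated] {A : ι → Set (Space N)} (hA : ∀ i, MeasurableSet (A i))
    (hAB : ∀ᶠ i in l, A i ⊆ B) (hlim : ∀ᵐ x, ∀ᶠ i in l, x ∉ A i) :
    Tendsto (fun i ↦ supOn V K q (A i)) l (𝓝 0) := by
  refine ENNReal.tendsto_nhds_zero.2 fun ε hε ↦ ?_
  by_contra hcon
  simp only [not_eventually, not_le] at hcon
  obtain ⟨i, hi, hεi⟩ := exists_seq_forall_of_frequently hcon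
  choose u hu hu₁ hεu using fun n ↦ exists_lt_of_lt_supOn hK (hA (i n)) (hεi n)
  obtain ⟨k, hk, hcauchy⟩ :=
    h.exists_subseq_tendsto_sub hq₁ hq₂ hV hc hu (M := 1) fun n ↦ by simp [hu₁]
  have hik : Tendsto (fun n ↦ i (k n)) atTop l := hi.comp hk.tendsto_atTop
  have htail (m : ℕ) : Tendsto (fun n ↦
      ∫⁻ x in A (i (k n)), ‖u m x‖ₑ ^ q ∂weightMeasure N K) atTop (𝓝 0) := by
    refine (tendsto_setLIntegral_of_eventually_notMem hB ?_ hA hAB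
      (weightMeasure_absolutelyContinuous.ae_le hlim)).comp hik
    refine (((hu m).lintegral_le_supOn hN hV hK hq hB).trans_lt ?_).ne
    simpa [hu₁] using h.supOn_lt_top hq₁ hq₂ hK hB hc.1
  have hη : 0 < ε / 2 / 2 ^ q := ENNReal.div_pos (ENNReal.half_pos hε.ne').ne' (by finiteness)
  obtain ⟨m, hm⟩ := (ENNReal.tendsto_nhds_zero.1 hcauchy _ hη).curry.exists
  obtain ⟨n, ⟨hnm, hn⟩, hnB⟩ := ((hm.and (ENNReal.tendsto_nhds_zero.1 (htail (k m)) _ hη)).and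
    (hik.eventually hAB)).exists
  refine (hεu (k n)).not_ge ?_
  calc ∫⁻ x in A (i (k n)), ‖u (k n) x‖ₑ ^ q ∂weightMeasure N K
      ≤ 2 ^ q * ∫⁻ x in A (i (k n)), ‖u (k n) x - u (k m) x‖ₑ ^ q ∂weightMeasure N K
        + 2 ^ q * ∫⁻ x in A (i (k n)), ‖u (k m) x‖ₑ ^ q ∂weightMeasure N K := by
        simpa using lintegral_rpow_le_of_le_add hq.le le_rfl
          (((hu (k n)).sub hV (hu (k m))).memHV.memD12.memLp.1.mono_ac
            weightMeasure_absolutelyContinuous).enorm.restrict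
          (.of_forall fun x ↦ by simpa using enorm_add_le (u (k n) x - u (k m) x) (u (k m) x))
          (.of_forall fun _ ↦ le_top)
    _ ≤ 2 ^ q * (ε / 2 / 2 ^ q) + 2 ^ q * (ε / 2 / 2 ^ q) := by
        gcongr
        exact (lintegral_mono_set hnB).trans hnm
    _ ≤ ε / 2 + ε / 2 := add_le_add ENNReal.mul_div_le ENNReal.mul_div_le
    _ = ε := ENNReal.add_halves ε

theorem condFinite_of_continuouslyEmbedded (hN : 3 ≤ N)
    (hV : AEMeasurable fun x : Space N ↦ V ‖x‖) (hK : LocallyIntegrableOn K (Set.Ioi 0))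
    (hq₁ : 0 < q₁) (hq : q₁ ≤ q₂) (hK₁ : IntegrableOn (fun x : Space N ↦ K ‖x‖) (Metric.ball 0 1))
    (h : ContinuouslyEmbedded N V K q₁ q₂) : CondFinite N V K q₁ q₂ :=
  have hq₂ : 0 < q₂ := hq₁.trans_le hq
  ⟨1, 1, one_pos, one_pos,
    (sumControls_of_measure_lt_top hq₁ hq (weightMeasure_lt_top_of_integrableOn
      measurableSet_ball hK₁)).supOn_lt_top hq₁ hq₂ hK measurableSet_ball h,
    (sumControls_compl_ball hN hV hq₁ hq one_pos).supOn_lt_top hq₁ hq₂ hK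
      measurableSet_ball.compl h⟩

theorem condVanishing_of_compactlyEmbedded (hN : 3 ≤ N)
    (hV : AEMeasurable fun x : Space N ↦ V ‖x‖) (hK : LocallyIntegrableOn K (Set.Ioi 0))
    (hq₁ : 0 < q₁) (hq : q₁ ≤ q₂) (hK₁ : IntegrableOn (fun x : Space N ↦ K ‖x‖) (Metric.ball 0 1))
    (h : CompactlyEmbedded N V K q₁ q₂) : CondVanishing N V K q₁ q₂ := by
  have hq₂ : 0 < q₂ := hq₁.trans_le hq
  constructor
  · refine (sumControls_of_measure_lt_top hq₁ hq (weightMeasure_lt_top_of_integrableOn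
      measurableSet_ball hK₁)).tendsto_supOn hq₁ hq₂ hq₁ hN hV hK h measurableSet_ball
      (A := fun R ↦ Metric.ball 0 R) (fun _ ↦ measurableSet_ball) ?_ ?_
    · filter_upwards [Ioc_mem_nhdsGT one_pos] with R hR using Metric.ball_subset_ball hR.2
    · filter_upwards [Measure.ae_ne volume 0] with x hx
      filter_upwards [Ioc_mem_nhdsGT (norm_pos_iff.2 hx)] with R hR
      simpa using hR.2
  · refine (sumControls_compl_ball hN hV hq₁ hq one_pos).tendsto_supOn hq₁ hq₂ hq₂ hN hV hK h
      measurableSet_ball.compl (A := fun R ↦ (Metric.ball 0 R)ᶜ)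
      (fun _ ↦ measurableSet_ball.compl) ?_ (.of_forall fun x ↦ ?_)
    · filter_upwards [eventually_ge_atTop 1] with R hR
      exact Set.compl_subset_compl.2 (Metric.ball_subset_ball hR)
    · filter_upwards [eventually_gt_atTop ‖x‖] with R hR
      simpa using hR

end Necessity

section

variable {N : ℕ} {K : ℝ → ℝ}

theorem IsPotentialK.locallyIntegrableOn (hN : 3 ≤ N) (hK : IsPotentialK N K) :
    LocallyIntegrableOn K (Set.Ioi 0) := by
  obtain ⟨s, hs, hKs⟩ := hK.locally_memLp
  have hs₁ : 1 ≤ s := by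
    have hN' : (3 : ℝ) ≤ N := by exact_mod_cast hN
    refine le_trans ?_ hs.le
    rw [le_div_iff₀ (by positivity)]
    linarith
  refine (locallyIntegrableOn_iff isOpen_Ioi.isLocallyClosed).2 fun k hk hkc ↦ ?_
  obtain rfl | hne := k.eq_empty_or_nonempty
  · simp
  obtain ⟨a, ha, hak⟩ := hkc.exists_isLeast hne
  obtain ⟨b, -, hbk⟩ := hkc.exists_isGreatest hne
  have hsub : k ⊆ Set.Icc a (max b (a + 1)) := fun x hx ↦ ⟨hak hx, le_max_of_le_left (hbk hx)⟩
  have hint : IntegrableOn K (Set.Icc a (max b (a + 1))) :=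
    (hKs a _ (hk ha) (by simp)).integrable (by simpa using hs₁)
  exact hint.mono_set hsub

end

end WeightedSobolev

end

theorem theorem2p1_general (N : ℕ) (hN : 3 ≤ N) (V : ℝ → ℝ≥0∞) (K : ℝ → ℝ)
    (hV : AEMeasurable V (volume.restrict (Set.Ioi 0))) (_hK₀ : ∀ r, 0 < r → 0 ≤ K r)
    (hK : LocallyIntegrableOn K (Set.Ioi 0)) (q₁ q₂ : ℝ) (hq₁ : 0 < q₁) (hq₂ : 0 < q₂) :
    (CondFinite N V K q₁ q₂ → ContinuouslyEmbedded N V K q₁ q₂) ∧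
    (CondVanishing N V K q₁ q₂ → CompactlyEmbedded N V K q₁ q₂) ∧
    (IntegrableOn (fun x : Space N ↦ K ‖x‖) (Metric.ball (0 : Space N) 1) → q₁ ≤ q₂ →
      (ContinuouslyEmbedded N V K q₁ q₂ → CondFinite N V K q₁ q₂) ∧
      (CompactlyEmbedded N V K q₁ q₂ → CondVanishing N V K q₁ q₂)) := by
  have : NeZero N := ⟨by omega⟩
  have hVn : AEMeasurable fun x : Space N ↦ V ‖x‖ :=
    hV.comp_quasiMeasurePreserving (quasiMeasurePreserving_norm volume)
  exact ⟨continuouslyEmbedded_of_condFinite hN hVn hK hq₁ hq₂,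
    compactlyEmbedded_of_condVanishing hN hVn hK hq₁ hq₂,
    fun hK₁ hq ↦ ⟨condFinite_of_continuouslyEmbedded hN hVn hK hq₁ hq hK₁,
      condVanishing_of_compactlyEmbedded hN hVn hK hq₁ hq hK₁⟩⟩

theorem theorem2p1 (N : ℕ) (hN : 3 ≤ N) (V : ℝ → ℝ≥0∞) (K : ℝ → ℝ)
    (hV : IsPotentialV V) (hK : IsPotentialK N K)
    (q₁ q₂ : ℝ) (hq₁ : 1 < q₁) (hq₂ : 1 < q₂) :
    (CondFinite N V K q₁ q₂ → ContinuouslyEmbedded N V K q₁ q₂) ∧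
    (CondVanishing N V K q₁ q₂ → CompactlyEmbedded N V K q₁ q₂) ∧
    (IntegrableOn (fun x : Space N => K ‖x‖) (Metric.ball (0 : Space N) 1) volume → q₁ ≤ q₂ →
      (ContinuouslyEmbedded N V K q₁ q₂ → CondFinite N V K q₁ q₂) ∧
      (CompactlyEmbedded N V K q₁ q₂ → CondVanishing N V K q₁ q₂)) := by
  exact theorem2p1_general N hN V K hV.measurable (fun r hr ↦ (hK.pos r hr).le)
    (hK.locallyIntegrableOn hN) q₁ q₂ (zero_lt_one.trans hq₁) (zero_lt_one.trans hq₂)
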